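/- Formulas are built from countably many propositional variables by $A ::= p_i \mid \bot \mid A\land A\mid A\lor A\mid A\to A\mid \Box A\mid \Diamond A$, with $\top:=\bot\to\bot$ and $\neg A:=A\to\bot$. **Axiom systems.** Consider the axiom schemes ($\land$-dual) $\neg(\Box A\land\Diamond\neg A)$, ($N_\Box$) $\Box\top$, ($C_\Box$) $\Box A\land\Box B\to\Box(A\land B)$, ($K_\Diamond$) $\Box(A\to B)\to(\Diamond A\to\Diamond B)$, ($P_\Diamond$) $\Diamond\top$, ($D$) $\Box A\to\Diamond A$, ($T_\Box$) $\Box A\to A$, ($T_\Diamond$) $A\to\Diamond A$, and the rules $\mathrm{Mon}_\Box$: $A\to B\,/\,\Box A\to\Box B$ and $\mathrm{Mon}_\Diamond$: $A\to B\,/\,\Diamond A\to\Diamond B$. The fourteen W-logics extend a Hilbert axiomatisation of intuitionistic propositional logic (with modus ponens), over the modal language, as follows: - $\mathsf{WM}=\mathrm{IPL}+\land\text{-dual}+\mathrm{Mon}_\Box+\mathrm{Mon}_\Diamond$; $\mathsf{WMN}=\mathsf{WM}+N_\Box$; $\mathsf{WMC}=\mathsf{WM}+C_\Box+K_\Diamond$;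 $\mathsf{WK}=\mathsf{WMC}+N_\Box$; - $\mathsf{WMP}=\mathsf{WM}+P_\Diamond$; $\mathsf{WMNP}=\mathsf{WMN}+P_\Diamond$; - $\mathsf{WMD}=\mathsf{WM}+D+P_\Diamond$; $\mathsf{WMND}=\mathsf{WMN}+D$; $\mathsf{WMCD}=\mathsf{WMC}+D+P_\Diamond$; $\mathsf{WKD}=\mathsf{WK}+D$; - $\mathsf{WMT}$, $\mathsf{WMNT}$, $\mathsf{WMCT}$, $\mathsf{WKT}$ are $\mathsf{WM}$, $\mathsf{WMN}$, $\mathsf{WMC}$, $\mathsf{WK}$ plus $T_\Box+T_\Diamond$. **Sequent calculi.** Sequents are $\Gamma\Rightarrow\Delta$ with $\Gamma$ a finite multiset of formulas and $\Delta$ consisting of at most one formula. All calculi contain the propositional rules of the cut-free calculus G3i: the initial sequents $\Gamma,p\Rightarrow p$ ($p$ a variable) and $\Gamma,\bot\Rightarrow\Delta$, and the rules $$\frac{\Gamma,A\to B\Rightarrow A\quad \Gamma,B\Rightarrow\Delta}{\Gamma,A\to B\Rightarrow\Delta}\quad \frac{\Gamma,A\Rightarrow B}{\Gamma\Rightarrow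 A\to B}\quad \frac{\Gamma\Rightarrow A\quad\Gamma\Rightarrow B}{\Gamma\Rightarrow A\land B}\quad \frac{\Gamma,A,B\Rightarrow\Delta}{\Gamma,A\land B\Rightarrow\Delta}$$ $$\frac{\Gamma\Rightarrow A_i}{\Gamma\Rightarrow A_1\lor A_2}\ (i\in\{1,2\})\quad \frac{\Gamma,A\Rightarrow\Delta\quad\Gamma,B\Rightarrow\Delta}{\Gamma,A\lor B\Rightarrow\Delta}.$$ The modal rules are (written premiss / conclusion, with $\Gamma,\Gamma'$ arbitrary multisets and $|\Delta|\le 1$): - $M_\Box$: $A\Rightarrow B\ /\ \Gamma,\Box A\Rightarrow\Box B$; $M_\Diamond$: $A\Rightarrow B\ /\ \Gamma,\Diamond A\Rightarrow\Diamond B$; $\mathrm{dual}_M$: $A,B\Rightarrow\ /\ \Gamma,\Box A,\Diamond B\Rightarrow\Delta$; - $N_\Box$: $\Rightarrow A\ /\ \Gamma\Rightarrow\Box A$; $N_\Diamond$: $A\Rightarrow\ /\ \Gamma,\Diamond A\Rightarrow\Delta$; - $C_\Box$: $\Gamma,A\Rightarrow B\ /\ \Gamma',\Box\Gamma,\Box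 A\Rightarrow\Box B$; $C_\Diamond$: $\Gamma,A\Rightarrow B\ /\ \Gamma',\Box\Gamma,\Diamond A\Rightarrow\Diamond B$; $\mathrm{dual}_C$: $\Gamma,A,B\Rightarrow\ /\ \Gamma',\Box\Gamma,\Box A,\Diamond B\Rightarrow\Delta$; - $K_\Box$: $\Gamma\Rightarrow A\ /\ \Gamma',\Box\Gamma\Rightarrow\Box A$; $K_\Diamond$: $\Gamma,A\Rightarrow B\ /\ \Gamma',\Box\Gamma,\Diamond A\Rightarrow\Diamond B$; $\mathrm{dual}_K$: $\Gamma,A\Rightarrow\ /\ \Gamma',\Box\Gamma,\Diamond A\Rightarrow\Delta$; - $P_\Box$: $A\Rightarrow\ /\ \Gamma,\Box A\Rightarrow\Delta$; $P_\Diamond$: $\Rightarrow A\ /\ \Gamma\Rightarrow\Diamond A$; - $D$: $A\Rightarrow B\ /\ \Gamma,\Box A\Rightarrow\Diamond B$; $D_\Box$: $A,B\Rightarrow\ /\ \Gamma,\Box A,\Box B\Rightarrow\Delta$; $CD$: $\Gamma\Rightarrow A\ /\ \Gamma',\Box\Gamma\Rightarrow\Diamond A$; $CD_\Box$: $\Gamma\Rightarrow\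 /\ \Gamma',\Box\Gamma\Rightarrow\Delta$; - $T_\Box$: $\Gamma,\Box A,A\Rightarrow\Delta\ /\ \Gamma,\Box A\Rightarrow\Delta$; $T_\Diamond$: $\Gamma\Rightarrow A\ /\ \Gamma\Rightarrow\Diamond A$. The modal rules of the calculi are: $\mathsf{G.WM}$: $M_\Box,M_\Diamond,\mathrm{dual}_M$; $\mathsf{G.WMN}$: $\mathsf{G.WM}+N_\Box+N_\Diamond$; $\mathsf{G.WMC}$: $C_\Box,C_\Diamond,\mathrm{dual}_C$; $\mathsf{G.WK}$: $K_\Box,K_\Diamond,\mathrm{dual}_K$; $\mathsf{G.WMP}$ and $\mathsf{G.WMNP}$: $\mathsf{G.WM}$, resp. $\mathsf{G.WMN}$, plus $P_\Box+P_\Diamond$; $\mathsf{G.WMD}$ and $\mathsf{G.WMND}$: $\mathsf{G.WM}$, resp. $\mathsf{G.WMN}$, plus $D+D_\Box+P_\Box+P_\Diamond$; $\mathsf{G.WMCD}$ and $\mathsf{G.WKD}$: $\mathsf{G.WMC}$, resp. $\mathsf{G.WK}$, plus $CD+CD_\Box$; $\mathsf{G.WMT}$, $\mathsf{G.WMNT}$,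 $\mathsf{G.WMCT}$, $\mathsf{G.WKT}$: $\mathsf{G.WM}$, $\mathsf{G.WMN}$, $\mathsf{G.WMC}$, $\mathsf{G.WK}$ plus $T_\Box+T_\Diamond$. **Theorem.** For each of the fourteen W-logics $\mathsf{WL}$ and every sequent $\Gamma\Rightarrow\Delta$ with $|\Delta|\le 1$: $$\mathsf{G.WL}\vdash\Gamma\Rightarrow\Delta\quad\text{if and only if}\quad \mathsf{WL}\vdash\bigwedge\Gamma\to\bigvee\Delta ,$$ where $\bigwedge\Gamma\to\bigvee\Delta$ is read as $\bigvee\Delta$ when $\Gamma$ is empty, $\bigvee\emptyset=\bot$, and $\bigwedge\Gamma$ is the conjunction of the members of $\Gamma$ in any order. -/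

import Mathlib

namespace WLogics

/-- Formulas of the propositional modal language with primitive `□` and `◇`,
over the countably many propositional variables `p₀, p₁, p₂, …`. -/
inductive Formula : Type
  | var : ℕ → Formula
  | bot : Formula
  | and : Formula → Formula → Formula
  | or : Formula → Formula → Formula
  | imp : Formula → Formula → Formula
  | box : Formula → Formula
  | dia : Formula → Formula

namespace Formula

/-- `⊤ := ⊥ → ⊥`. -/
def top : Formula := imp bot bot

/-- `¬A := A → ⊥`. -/
def neg (A : Formula) : Formula := imp A bot

/-- The conjunction of the non-empty list `A, l`; a one-element list has its only entry
as conjunction. -/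
def conj : Formula → List Formula → Formula
  | A, [] => A
  | A, B :: l => and A (conj B l)

/-- The disjunction of at most one formula; the empty disjunction is `⊥`. -/
def disj : Option Formula → Formula
  | none => bot
  | some A => A

/-- The formula interpretation of the sequent with antecedent listed by `l` and succedent `Δ`:
`⋀ l → ⋁ Δ` if `l` is non-empty, and `⋁ Δ` if `l` is empty. -/
def interp : List Formula → Option Formula → Formula
  | [], Δ => disj Δ
  | A :: l, Δ => imp (conj A l) (disj Δ)

end Formula

open Formula

/-- The fourteen W-logics; the constructor `X` stands for the logic `WX`. -/
inductive WLogic : Type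
  | M | MN | MC | K
  | MP | MNP
  | MD | MND | MCD | KD
  | MT | MNT | MCT | KT

/-! ### Hilbert systems -/

/-- All instances of the axiom schemes of a standard Hilbert axiomatisation of
intuitionistic propositional logic (its only rule is modus ponens). -/
inductive IPLAxiom : Formula → Prop
  | k (A B : Formula) : IPLAxiom (imp A (imp B A))
  | s (A B C : Formula) :
      IPLAxiom (imp (imp A (imp B C)) (imp (imp A B) (imp A C)))
  | andLeft (A B : Formula) : IPLAxiom (imp (and A B) A)
  | andRight (A B : Formula) : IPLAxiom (imp (and A B) B)
  | andIntro (A B : Formula) : IPLAxiom (imp A (imp B (and A B)))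
  | orLeft (A B : Formula) : IPLAxiom (imp A (or A B))
  | orRight (A B : Formula) : IPLAxiom (imp B (or A B))
  | orElim (A B C : Formula) :
      IPLAxiom (imp (imp A C) (imp (imp B C) (imp (or A B) C)))
  | exFalso (A : Formula) : IPLAxiom (imp bot A)

/-- Names of the modal axiom schemes. -/
inductive AxiomName : Type
  | dualAnd | Nbox | Cbox | Kdia | Pdia | D | Tbox | Tdia

/-- The instances of each modal axiom scheme. -/
inductive ModalAxiom : AxiomName → Formula → Prop
  | dualAnd (A : Formula) : ModalAxiom .dualAnd (neg (and (box A) (dia (neg A))))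
  | Nbox : ModalAxiom .Nbox (box top)
  | Cbox (A B : Formula) :
      ModalAxiom .Cbox (imp (and (box A) (box B)) (box (and A B)))
  | Kdia (A B : Formula) :
      ModalAxiom .Kdia (imp (box (imp A B)) (imp (dia A) (dia B)))
  | Pdia : ModalAxiom .Pdia (dia top)
  | D (A : Formula) : ModalAxiom .D (imp (box A) (dia A))
  | Tbox (A : Formula) : ModalAxiom .Tbox (imp (box A) A)
  | Tdia (A : Formula) : ModalAxiom .Tdia (imp A (dia A))

/-- The modal axioms of each W-logic; the rules of monotonicity for `□` and `◇` belong to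
every W-logic and are built into `Theorem`. -/
def WLogic.axioms : WLogic → Set AxiomName
  | .M => {.dualAnd}
  | .MN => {.dualAnd, .Nbox}
  | .MC => {.dualAnd, .Cbox, .Kdia}
  | .K => {.dualAnd, .Cbox, .Kdia, .Nbox}
  | .MP => {.dualAnd, .Pdia}
  | .MNP => {.dualAnd, .Nbox, .Pdia}
  | .MD => {.dualAnd, .D, .Pdia}
  | .MND => {.dualAnd, .Nbox, .D}
  | .MCD => {.dualAnd, .Cbox, .Kdia, .D, .Pdia}
  | .KD => {.dualAnd, .Cbox, .Kdia, .Nbox, .D}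
  | .MT => {.dualAnd, .Tbox, .Tdia}
  | .MNT => {.dualAnd, .Nbox, .Tbox, .Tdia}
  | .MCT => {.dualAnd, .Cbox, .Kdia, .Tbox, .Tdia}
  | .KT => {.dualAnd, .Cbox, .Kdia, .Nbox, .Tbox, .Tdia}

/-- `Theorem L A`: the formula `A` is a theorem of the Hilbert system of the W-logic `L`. -/
inductive Theorem (L : WLogic) : Formula → Prop
  | ipl {A : Formula} : IPLAxiom A → Theorem L A
  | modal {a : AxiomName} {A : Formula} : a ∈ L.axioms → ModalAxiom a A → Theorem L A
  | mp {A B : Formula} : Theorem L (imp A B) → Theorem L A → Theorem L B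
  | monBox {A B : Formula} : Theorem L (imp A B) → Theorem L (imp (box A) (box B))
  | monDia {A B : Formula} : Theorem L (imp A B) → Theorem L (imp (dia A) (dia B))

/-! ### Sequent calculi -/

/-- Single-succedent sequents: a finite multiset of formulas on the left, at most one formula
on the right. -/
structure Sequent : Type where
  ant : Multiset Formula
  suc : Option Formula

infix:45 " ⇒ " => Sequent.mk

/-- Names of the modal sequent rules. -/
inductive RuleName : Type
  | Mbox | Mdia | dualAndM | Nbox | Ndia
  | Cbox | Cdia | dualAndC
  | Kbox | Kdia | dualAndK
  | Pbox | Pdia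
  | D | Dbox | CD | CDbox
  | Tbox | Tdia

/-- `ModalRule r S S'`: the sequent `S'` follows from the premiss `S` by one application of the
modal rule `r`. Here `Γ.map box` is `□Γ`. -/
inductive ModalRule : RuleName → Sequent → Sequent → Prop
  | Mbox (Γ : Multiset Formula) (A B : Formula) :
      ModalRule .Mbox ({A} ⇒ some B) (box A ::ₘ Γ ⇒ some (box B))
  | Mdia (Γ : Multiset Formula) (A B : Formula) :
      ModalRule .Mdia ({A} ⇒ some B) (dia A ::ₘ Γ ⇒ some (dia B))
  | dualAndM (Γ : Multiset Formula) (Δ : Option Formula) (A B : Formula) :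
      ModalRule .dualAndM ({A, B} ⇒ none) (box A ::ₘ dia B ::ₘ Γ ⇒ Δ)
  | Nbox (Γ : Multiset Formula) (A : Formula) :
      ModalRule .Nbox (0 ⇒ some A) (Γ ⇒ some (box A))
  | Ndia (Γ : Multiset Formula) (Δ : Option Formula) (A : Formula) :
      ModalRule .Ndia ({A} ⇒ none) (dia A ::ₘ Γ ⇒ Δ)
  | Cbox (Γ Γ' : Multiset Formula) (A B : Formula) :
      ModalRule .Cbox (A ::ₘ Γ ⇒ some B) (box A ::ₘ (Γ' + Γ.map box) ⇒ some (box B))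
  | Cdia (Γ Γ' : Multiset Formula) (A B : Formula) :
      ModalRule .Cdia (A ::ₘ Γ ⇒ some B) (dia A ::ₘ (Γ' + Γ.map box) ⇒ some (dia B))
  | dualAndC (Γ Γ' : Multiset Formula) (Δ : Option Formula) (A B : Formula) :
      ModalRule .dualAndC (A ::ₘ B ::ₘ Γ ⇒ none)
        (box A ::ₘ dia B ::ₘ (Γ' + Γ.map box) ⇒ Δ)
  | Kbox (Γ Γ' : Multiset Formula) (A : Formula) :
      ModalRule .Kbox (Γ ⇒ some A) (Γ' + Γ.map box ⇒ some (box A))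
  | Kdia (Γ Γ' : Multiset Formula) (A B : Formula) :
      ModalRule .Kdia (A ::ₘ Γ ⇒ some B) (dia A ::ₘ (Γ' + Γ.map box) ⇒ some (dia B))
  | dualAndK (Γ Γ' : Multiset Formula) (Δ : Option Formula) (A : Formula) :
      ModalRule .dualAndK (A ::ₘ Γ ⇒ none) (dia A ::ₘ (Γ' + Γ.map box) ⇒ Δ)
  | Pbox (Γ : Multiset Formula) (Δ : Option Formula) (A : Formula) :
      ModalRule .Pbox ({A} ⇒ none) (box A ::ₘ Γ ⇒ Δ)
  | Pdia (Γ : Multiset Formula) (A : Formula) :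
      ModalRule .Pdia (0 ⇒ some A) (Γ ⇒ some (dia A))
  | D (Γ : Multiset Formula) (A B : Formula) :
      ModalRule .D ({A} ⇒ some B) (box A ::ₘ Γ ⇒ some (dia B))
  | Dbox (Γ : Multiset Formula) (Δ : Option Formula) (A B : Formula) :
      ModalRule .Dbox ({A, B} ⇒ none) (box A ::ₘ box B ::ₘ Γ ⇒ Δ)
  | CD (Γ Γ' : Multiset Formula) (A : Formula) :
      ModalRule .CD (Γ ⇒ some A) (Γ' + Γ.map box ⇒ some (dia A))
  | CDbox (Γ Γ' : Multiset Formula) (Δ : Option Formula) :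
      ModalRule .CDbox (Γ ⇒ none) (Γ' + Γ.map box ⇒ Δ)
  | Tbox (Γ : Multiset Formula) (Δ : Option Formula) (A : Formula) :
      ModalRule .Tbox (A ::ₘ box A ::ₘ Γ ⇒ Δ) (box A ::ₘ Γ ⇒ Δ)
  | Tdia (Γ : Multiset Formula) (A : Formula) :
      ModalRule .Tdia (Γ ⇒ some A) (Γ ⇒ some (dia A))

/-- The modal rules of the calculus of each W-logic. -/
def WLogic.rules : WLogic → Set RuleName
  | .M => {.Mbox, .Mdia, .dualAndM}
  | .MN => {.Mbox, .Mdia, .dualAndM, .Nbox, .Ndia}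
  | .MC => {.Cbox, .Cdia, .dualAndC}
  | .K => {.Kbox, .Kdia, .dualAndK}
  | .MP => {.Mbox, .Mdia, .dualAndM, .Pbox, .Pdia}
  | .MNP => {.Mbox, .Mdia, .dualAndM, .Nbox, .Ndia, .Pbox, .Pdia}
  | .MD => {.Mbox, .Mdia, .dualAndM, .D, .Dbox, .Pbox, .Pdia}
  | .MND => {.Mbox, .Mdia, .dualAndM, .Nbox, .Ndia, .D, .Dbox, .Pbox, .Pdia}
  | .MCD => {.Cbox, .Cdia, .dualAndC, .CD, .CDbox}
  | .KD => {.Kbox, .Kdia, .dualAndK, .CD, .CDbox}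
  | .MT => {.Mbox, .Mdia, .dualAndM, .Tbox, .Tdia}
  | .MNT => {.Mbox, .Mdia, .dualAndM, .Nbox, .Ndia, .Tbox, .Tdia}
  | .MCT => {.Cbox, .Cdia, .dualAndC, .Tbox, .Tdia}
  | .KT => {.Kbox, .Kdia, .dualAndK, .Tbox, .Tdia}

/-- `Derivable L S`: the sequent `S` is derivable in the calculus `G.WL`, which consists of the
propositional rules of the cut-free single-succedent calculus `G3i` and the modal rules
of `L`. -/
inductive Derivable (L : WLogic) : Sequent → Prop
  | init (Γ : Multiset Formula) (n : ℕ) : Derivable L (var n ::ₘ Γ ⇒ some (var n))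
  | botL (Γ : Multiset Formula) (Δ : Option Formula) : Derivable L (bot ::ₘ Γ ⇒ Δ)
  | impL {Γ : Multiset Formula} {Δ : Option Formula} {A B : Formula} :
      Derivable L (imp A B ::ₘ Γ ⇒ some A) → Derivable L (B ::ₘ Γ ⇒ Δ) →
      Derivable L (imp A B ::ₘ Γ ⇒ Δ)
  | impR {Γ : Multiset Formula} {A B : Formula} :
      Derivable L (A ::ₘ Γ ⇒ some B) → Derivable L (Γ ⇒ some (imp A B))
  | andR {Γ : Multiset Formula} {A B : Formula} :
      Derivable L (Γ ⇒ some A) → Derivable L (Γ ⇒ some B) →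
      Derivable L (Γ ⇒ some (and A B))
  | andL {Γ : Multiset Formula} {Δ : Option Formula} {A B : Formula} :
      Derivable L (A ::ₘ B ::ₘ Γ ⇒ Δ) → Derivable L (and A B ::ₘ Γ ⇒ Δ)
  | orR₁ {Γ : Multiset Formula} {A B : Formula} :
      Derivable L (Γ ⇒ some A) → Derivable L (Γ ⇒ some (or A B))
  | orR₂ {Γ : Multiset Formula} {A B : Formula} :
      Derivable L (Γ ⇒ some B) → Derivable L (Γ ⇒ some (or A B))
  | orL {Γ : Multiset Formula} {Δ : Option Formula} {A B : Formula} :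
      Derivable L (A ::ₘ Γ ⇒ Δ) → Derivable L (B ::ₘ Γ ⇒ Δ) →
      Derivable L (or A B ::ₘ Γ ⇒ Δ)
  | modal {r : RuleName} {S S' : Sequent} :
      r ∈ L.rules → ModalRule r S S' → Derivable L S → Derivable L S'

end WLogics

/-!
The two directions are a soundness proof and a cut elimination proof.

All modal rules of the fourteen calculi except `T_□` and `T_◇` are instances of one scheme: from
`Ξ, D ⇒ Θ` infer `Γ, □Ξ, ◇D ⇒ Δ`, where `D` has at most one member and `Δ` is arbitrary (with `Θ`
empty), or `□Θ`, or `◇Θ`. A calculus is then determined by the presence of the `T` rules and by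
the set of triples `(|Ξ|, |D|, kind of succedent)` that its rules allow, `WLogic.Jump`. What cut
elimination needs from the modal rules are three closure properties of this set:
`WLogic.Jump.contract` (one formula `□A` fewer, as long as one remains), `WLogic.Jump.cut_box` and
`WLogic.Jump.cut_dia` (composing a rule that introduces `□A` or `◇A` on the right with a rule in
which it is principal on the left). They are checked for each of the fourteen logics.

Weakening, inversion of the left rules for `∧`, `∨`, `→`, and contraction
(`Derivable.contract`, by induction on the formula and then on the derivation) give
`Derivable.mono`: derivability depends on the antecedent only as a set, and monotonically. All
rules may therefore be used with principal formulas kept in the premisses, and cut takes the form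
`CutAdmissible`. It is proved by induction on the cut formula. The left derivation is traversed
until its last rule introduces the cut formula (`RightForm`); then the right derivation is
traversed (`RightForm.cut`), and where the cut formula is principal the cut is replaced by cuts on
its components. Since premisses keep their principal formulas, no measure on derivations is needed.

With cut, every Hilbert proof becomes a derivation (`Theorem.derivable`), and the formula
interpretation of a sequent can be taken apart again (`Derivable.of_interp`). Conversely
`Derivable.entails` shows that derivable sequents are valid for `Entails`, the consequence relation
of the Hilbert system with hypotheses, for which the deduction theorem holds. For the modal rules
this is `Entails.jump`: the formulas `□Ξ` are first collected into one `□C`, where `C` entails each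
member of `Ξ`, using `C_□` if there are several.
-/

namespace WLogics

open Formula

/-! ### The modal rules as instances of one scheme -/

/-- What a modal rule does to the succedent: discard the empty succedent of the premiss and allow
an arbitrary one, or prefix the succedent with `□`, or prefix it with `◇`. -/
inductive Target : Type
  | none | box | dia

/-- `k.Rel Θ Δ`: a modal rule of target `k` may have succedent `Θ` in the premiss and `Δ` in the
conclusion. -/
inductive Target.Rel : Target → Option Formula → Option Formula → Prop
  | none (Δ : Option Formula) : Target.Rel .none Option.none Δ
  | box (A : Formula) : Target.Rel .box (some A) (some (Formula.box A))
  | dia (A : Formula) : Target.Rel .dia (some A) (some (Formula.dia A))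

/-- `r.Shape n d k`: the rule `r` has instances that unbox `n` formulas `□A` and `d` formulas `◇B`
of the antecedent and act on the succedent as `k` says. The rules `T_□` and `T_◇` are not of this
kind, since their premisses keep the context. -/
def RuleName.Shape : RuleName → ℕ → ℕ → Target → Prop
  | .Mbox, n, d, k => n = 1 ∧ d = 0 ∧ k = .box
  | .Mdia, n, d, k => n = 0 ∧ d = 1 ∧ k = .dia
  | .dualAndM, n, d, k => n = 1 ∧ d = 1 ∧ k = .none
  | .Nbox, n, d, k => n = 0 ∧ d = 0 ∧ k = .box
  | .Ndia, n, d, k => n = 0 ∧ d = 1 ∧ k = .none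
  | .Cbox, n, d, k => 1 ≤ n ∧ d = 0 ∧ k = .box
  | .Cdia, _, d, k => d = 1 ∧ k = .dia
  | .dualAndC, n, d, k => 1 ≤ n ∧ d = 1 ∧ k = .none
  | .Kbox, _, d, k => d = 0 ∧ k = .box
  | .Kdia, _, d, k => d = 1 ∧ k = .dia
  | .dualAndK, _, d, k => d = 1 ∧ k = .none
  | .Pbox, n, d, k => n = 1 ∧ d = 0 ∧ k = .none
  | .Pdia, n, d, k => n = 0 ∧ d = 0 ∧ k = .dia
  | .D, n, d, k => n = 1 ∧ d = 0 ∧ k = .dia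
  | .Dbox, n, d, k => n = 2 ∧ d = 0 ∧ k = .none
  | .CD, _, d, k => d = 0 ∧ k = .dia
  | .CDbox, _, d, k => d = 0 ∧ k = .none
  | .Tbox, _, _, _ => False
  | .Tdia, _, _, _ => False

theorem ModalRule.of_shape {r : RuleName} {k : Target} {Γ Ξ D : Multiset Formula}
    {Θ Δ : Option Formula} (h : r.Shape Ξ.card D.card k) (hk : k.Rel Θ Δ) :
    ModalRule r (Ξ + D ⇒ Θ) (Γ + Ξ.map box + D.map dia ⇒ Δ) := by
  cases r <;> simp only [RuleName.Shape, Multiset.card_eq_one, Multiset.card_eq_zero] at h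
  case Mbox =>
    obtain ⟨⟨A, rfl⟩, rfl, rfl⟩ := h
    cases hk
    simpa [← Multiset.singleton_add, add_comm] using ModalRule.Mbox Γ A _
  case Mdia =>
    obtain ⟨rfl, ⟨A, rfl⟩, rfl⟩ := h
    cases hk
    simpa [← Multiset.singleton_add, add_comm] using ModalRule.Mdia Γ A _
  case dualAndM =>
    obtain ⟨⟨A, rfl⟩, ⟨B, rfl⟩, rfl⟩ := h
    cases hk
    convert ModalRule.dualAndM Γ Δ A B using 2 <;> simp [← Multiset.singleton_add]
    abel
  case Nbox =>
    obtain ⟨rfl, rfl, rfl⟩ := h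
    cases hk
    simpa using ModalRule.Nbox Γ _
  case Ndia =>
    obtain ⟨rfl, ⟨A, rfl⟩, rfl⟩ := h
    cases hk
    simpa [← Multiset.singleton_add, add_comm] using ModalRule.Ndia Γ Δ A
  case Cbox =>
    obtain ⟨h, rfl, rfl⟩ := h
    obtain ⟨A, hA⟩ := Multiset.card_pos_iff_exists_mem.1 h
    obtain ⟨Ξ, rfl⟩ := Multiset.exists_cons_of_mem hA
    cases hk
    simpa using ModalRule.Cbox Ξ Γ A _
  case Cdia =>
    obtain ⟨⟨A, rfl⟩, rfl⟩ := h
    cases hk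
    convert ModalRule.Cdia Ξ Γ A _ using 2 <;> simp [← Multiset.singleton_add, add_comm]
  case dualAndC =>
    obtain ⟨h, ⟨B, rfl⟩, rfl⟩ := h
    obtain ⟨A, hA⟩ := Multiset.card_pos_iff_exists_mem.1 h
    obtain ⟨Ξ, rfl⟩ := Multiset.exists_cons_of_mem hA
    cases hk
    convert ModalRule.dualAndC Ξ Γ Δ A B using 2 <;> simp [← Multiset.singleton_add] <;> abel
  case Kbox =>
    obtain ⟨rfl, rfl⟩ := h
    cases hk
    simpa using ModalRule.Kbox Ξ Γ _
  case Kdia =>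
    obtain ⟨⟨A, rfl⟩, rfl⟩ := h
    cases hk
    convert ModalRule.Kdia Ξ Γ A _ using 2 <;> simp [← Multiset.singleton_add, add_comm]
  case dualAndK =>
    obtain ⟨⟨A, rfl⟩, rfl⟩ := h
    cases hk
    convert ModalRule.dualAndK Ξ Γ Δ A using 2 <;> simp [← Multiset.singleton_add, add_comm]
  case Pbox =>
    obtain ⟨⟨A, rfl⟩, rfl, rfl⟩ := h
    cases hk
    simpa [← Multiset.singleton_add, add_comm] using ModalRule.Pbox Γ Δ A
  case Pdia =>
    obtain ⟨rfl, rfl, rfl⟩ := h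
    cases hk
    simpa using ModalRule.Pdia Γ _
  case D =>
    obtain ⟨⟨A, rfl⟩, rfl, rfl⟩ := h
    cases hk
    simpa [← Multiset.singleton_add, add_comm] using ModalRule.D Γ A _
  case Dbox =>
    obtain ⟨h, rfl, rfl⟩ := h
    obtain ⟨A, B, rfl⟩ := Multiset.card_eq_two.1 h
    cases hk
    convert ModalRule.Dbox Γ Δ A B using 2
    · simp
    · simp [← Multiset.singleton_add]; abel
  case CD =>
    obtain ⟨rfl, rfl⟩ := h
    cases hk
    simpa using ModalRule.CD Ξ Γ _
  case CDbox =>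
    obtain ⟨rfl, rfl⟩ := h
    cases hk
    simpa using ModalRule.CDbox Ξ Γ Δ

/-- `L.Jump n d k`: either some modal rule of `G.WL` has the shape `n, d, k`, or the rule is the
one from `⇒` to an arbitrary sequent. The latter is an instance of weakening, and including it
makes the set of shapes closed under composition by cuts: for example `N_□` cut against `P_□`
leaves a rule of this shape. -/
def WLogic.Jump (L : WLogic) (n d : ℕ) (k : Target) : Prop :=
  (n = 0 ∧ d = 0 ∧ k = .none) ∨ ∃ r ∈ L.rules, r.Shape n d k

/-- Every modal rule other than `T_□` and `T_◇` passes from `Ξ, D ⇒ Θ` to `Γ, □Ξ, ◇D ⇒ Δ`. -/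
theorem ModalRule.shape_or_T {r : RuleName} {S S' : Sequent} (h : ModalRule r S S') :
    (∃ (Γ Ξ D : Multiset Formula) (k : Target), r.Shape Ξ.card D.card k ∧ k.Rel S.suc S'.suc ∧
        S.ant = Ξ + D ∧ S'.ant = Γ + Ξ.map box + D.map dia) ∨
      (r = .Tbox ∧ ∃ Γ Δ A, S = (A ::ₘ box A ::ₘ Γ ⇒ Δ) ∧ S' = (box A ::ₘ Γ ⇒ Δ)) ∨
      (r = .Tdia ∧ ∃ Γ A, S = (Γ ⇒ some A) ∧ S' = (Γ ⇒ some (dia A))) := by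
  cases h
  case Tbox Γ Δ A => exact .inr (.inl ⟨rfl, Γ, Δ, A, rfl, rfl⟩)
  case Tdia Γ A => exact .inr (.inr ⟨rfl, Γ, A, rfl, rfl⟩)
  case Mbox Γ A B =>
    refine .inl ⟨Γ, {A}, 0, .box, by simp [RuleName.Shape], .box B, ?_, ?_⟩ <;>
      simp [← Multiset.singleton_add, add_comm]
  case Mdia Γ A B =>
    refine .inl ⟨Γ, 0, {A}, .dia, by simp [RuleName.Shape], .dia B, ?_, ?_⟩ <;>
      simp [← Multiset.singleton_add, add_comm]
  case dualAndM Γ Δ A B =>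
    refine .inl ⟨Γ, {A}, {B}, .none, by simp [RuleName.Shape], .none Δ, ?_, ?_⟩ <;>
      simp [← Multiset.singleton_add]
    abel
  case Nbox Γ A =>
    exact .inl ⟨Γ, 0, 0, .box, by simp [RuleName.Shape], .box A, by simp, by simp⟩
  case Ndia Γ Δ A =>
    refine .inl ⟨Γ, 0, {A}, .none, by simp [RuleName.Shape], .none Δ, ?_, ?_⟩ <;>
      simp [← Multiset.singleton_add, add_comm]
  case Cbox Γ Γ' A B =>
    refine .inl ⟨Γ', A ::ₘ Γ, 0, .box, by simp [RuleName.Shape], .box B, ?_, ?_⟩ <;> simp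
  case Cdia Γ Γ' A B =>
    refine .inl ⟨Γ', Γ, {A}, .dia, by simp [RuleName.Shape], .dia B, ?_, ?_⟩ <;>
      simp [← Multiset.singleton_add, add_comm]
  case dualAndC Γ Γ' Δ A B =>
    refine .inl ⟨Γ', A ::ₘ Γ, {B}, .none, by simp [RuleName.Shape], .none Δ, ?_, ?_⟩ <;>
      simp [← Multiset.singleton_add] <;> abel
  case Kbox Γ Γ' A =>
    refine .inl ⟨Γ', Γ, 0, .box, by simp [RuleName.Shape], .box A, ?_, ?_⟩ <;> simp
  case Kdia Γ Γ' A B =>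
    refine .inl ⟨Γ', Γ, {A}, .dia, by simp [RuleName.Shape], .dia B, ?_, ?_⟩ <;>
      simp [← Multiset.singleton_add, add_comm]
  case dualAndK Γ Γ' Δ A =>
    refine .inl ⟨Γ', Γ, {A}, .none, by simp [RuleName.Shape], .none Δ, ?_, ?_⟩ <;>
      simp [← Multiset.singleton_add, add_comm]
  case Pbox Γ Δ A =>
    refine .inl ⟨Γ, {A}, 0, .none, by simp [RuleName.Shape], .none Δ, ?_, ?_⟩ <;>
      simp [← Multiset.singleton_add, add_comm]
  case Pdia Γ A =>
    exact .inl ⟨Γ, 0, 0, .dia, by simp [RuleName.Shape], .dia A, by simp, by simp⟩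
  case D Γ A B =>
    refine .inl ⟨Γ, {A}, 0, .dia, by simp [RuleName.Shape], .dia B, ?_, ?_⟩ <;>
      simp [← Multiset.singleton_add, add_comm]
  case Dbox Γ Δ A B =>
    refine .inl ⟨Γ, {A, B}, 0, .none, by simp [RuleName.Shape], .none Δ, ?_, ?_⟩ <;>
      simp [← Multiset.singleton_add]
    abel
  case CD Γ Γ' A =>
    refine .inl ⟨Γ', Γ, 0, .dia, by simp [RuleName.Shape], .dia A, ?_, ?_⟩ <;> simp
  case CDbox Γ Γ' Δ =>
    refine .inl ⟨Γ', Γ, 0, .none, by simp [RuleName.Shape], .none Δ, ?_, ?_⟩ <;> simp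

namespace WLogic.Jump

variable {L : WLogic} {n m d d' : ℕ} {k : Target}

theorem dia_le_one (h : L.Jump n d k) : d ≤ 1 := by
  cases L <;> cases k <;> simp [WLogic.Jump, WLogic.rules, RuleName.Shape] at h <;> omega

theorem not_dia_of_box (h : L.Jump n d .box) : d = 0 := by
  cases L <;> simp [WLogic.Jump, WLogic.rules, RuleName.Shape] at h <;> omega

theorem contract (h : L.Jump (n + 2) d k) : L.Jump (n + 1) d k := by
  cases L <;> cases k <;> simp [WLogic.Jump, WLogic.rules, RuleName.Shape] at h ⊢ <;> omega

theorem of_le (h : L.Jump n d k) (hm : 1 ≤ m) (hmn : m ≤ n) : L.Jump m d k := by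
  induction n, hmn using Nat.le_induction with
  | base => exact h
  | succ n hmn ih =>
    obtain ⟨n, rfl⟩ := Nat.exists_eq_add_of_le' (hm.trans hmn)
    exact ih h.contract

/-- The shapes are closed under cuts on a formula `□A`. -/
theorem cut_box (h : L.Jump n d .box) (h' : L.Jump (m + 1) d' k) :
    L.Jump (n + m) (d + d') k := by
  cases L <;> cases k <;> simp [WLogic.Jump, WLogic.rules, RuleName.Shape] at h h' ⊢ <;> omega

/-- The shapes are closed under cuts on a formula `◇A`. -/
theorem cut_dia (h : L.Jump n d .dia) (h' : L.Jump m 1 k) : L.Jump (n + m) d k := by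
  cases L <;> cases k <;> simp [WLogic.Jump, WLogic.rules, RuleName.Shape] at h h' ⊢ <;> omega

theorem box_self (L : WLogic) : L.Jump 1 0 .box := by
  cases L <;> simp [WLogic.Jump, WLogic.rules, RuleName.Shape]

theorem dia_self (L : WLogic) : L.Jump 0 1 .dia := by
  cases L <;> simp [WLogic.Jump, WLogic.rules, RuleName.Shape]

theorem box_dia_none (L : WLogic) : L.Jump 1 1 .none := by
  cases L <;> simp [WLogic.Jump, WLogic.rules, RuleName.Shape]

end WLogic.Jump

theorem WLogic.Tbox_mem_iff_Tdia_mem (L : WLogic) : RuleName.Tbox ∈ L.rules ↔ .Tdia ∈ L.rules := by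
  cases L <;> simp [WLogic.rules]

/-! ### Structural rules -/

namespace Derivable

variable {L : WLogic}

/-- Induction on derivations, with all modal rules other than `T_□` and `T_◇` treated as one. -/
theorem induct {motive : Multiset Formula → Option Formula → Prop}
    (init : ∀ Γ n, motive (var n ::ₘ Γ) (some (var n)))
    (botL : ∀ Γ Δ, motive (bot ::ₘ Γ) Δ)
    (impL : ∀ Γ Δ A B, Derivable L (imp A B ::ₘ Γ ⇒ some A) → Derivable L (B ::ₘ Γ ⇒ Δ) →
      motive (imp A B ::ₘ Γ) (some A) → motive (B ::ₘ Γ) Δ → motive (imp A B ::ₘ Γ) Δ)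
    (impR : ∀ Γ A B, Derivable L (A ::ₘ Γ ⇒ some B) → motive (A ::ₘ Γ) (some B) →
      motive Γ (some (imp A B)))
    (andR : ∀ Γ A B, Derivable L (Γ ⇒ some A) → Derivable L (Γ ⇒ some B) →
      motive Γ (some A) → motive Γ (some B) → motive Γ (some (and A B)))
    (andL : ∀ Γ Δ A B, Derivable L (A ::ₘ B ::ₘ Γ ⇒ Δ) → motive (A ::ₘ B ::ₘ Γ) Δ →
      motive (and A B ::ₘ Γ) Δ)
    (orR₁ : ∀ Γ A B, Derivable L (Γ ⇒ some A) → motive Γ (some A) → motive Γ (some (or A B)))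
    (orR₂ : ∀ Γ A B, Derivable L (Γ ⇒ some B) → motive Γ (some B) → motive Γ (some (or A B)))
    (orL : ∀ Γ Δ A B, Derivable L (A ::ₘ Γ ⇒ Δ) → Derivable L (B ::ₘ Γ ⇒ Δ) →
      motive (A ::ₘ Γ) Δ → motive (B ::ₘ Γ) Δ → motive (or A B ::ₘ Γ) Δ)
    (jump : ∀ Γ Ξ D r k Θ Δ, r ∈ L.rules → r.Shape Ξ.card D.card k → k.Rel Θ Δ →
      Derivable L (Ξ + D ⇒ Θ) → motive (Ξ + D) Θ → motive (Γ + Ξ.map box + D.map dia) Δ)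
    (Tbox : ∀ Γ Δ A, .Tbox ∈ L.rules → Derivable L (A ::ₘ box A ::ₘ Γ ⇒ Δ) →
      motive (A ::ₘ box A ::ₘ Γ) Δ → motive (box A ::ₘ Γ) Δ)
    (Tdia : ∀ Γ A, .Tdia ∈ L.rules → Derivable L (Γ ⇒ some A) → motive Γ (some A) →
      motive Γ (some (dia A)))
    {Γ : Multiset Formula} {Δ : Option Formula} (h : Derivable L (Γ ⇒ Δ)) : motive Γ Δ := by
  suffices ∀ S, Derivable L S → motive S.ant S.suc from this _ h
  intro S h
  induction h with
  | init Γ n => exact init Γ n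
  | botL Γ Δ => exact botL Γ Δ
  | impL h₁ h₂ ih₁ ih₂ => exact impL _ _ _ _ h₁ h₂ ih₁ ih₂
  | impR h ih => exact impR _ _ _ h ih
  | andR h₁ h₂ ih₁ ih₂ => exact andR _ _ _ h₁ h₂ ih₁ ih₂
  | andL h ih => exact andL _ _ _ _ h ih
  | orR₁ h ih => exact orR₁ _ _ _ h ih
  | orR₂ h ih => exact orR₂ _ _ _ h ih
  | orL h₁ h₂ ih₁ ih₂ => exact orL _ _ _ _ h₁ h₂ ih₁ ih₂
  | @modal r S S' hr hS h ih =>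
    rcases hS.shape_or_T with ⟨Γ, Ξ, D, k, hs, hk, hS, hS'⟩ | ⟨rfl, Γ, Δ, A, rfl, rfl⟩ |
      ⟨rfl, Γ, A, rfl, rfl⟩
    · rw [hS'] at *
      rw [hS] at ih
      refine jump _ _ _ _ _ _ _ hr hs hk ?_ ih
      rwa [← hS]
    · exact Tbox _ _ _ hr h ih
    · exact Tdia _ _ hr h ih

theorem weakenRight {Γ : Multiset Formula} {Δ Δ' : Option Formula} (h : Derivable L (Γ ⇒ Δ))
    (hΔ : Δ = none) : Derivable L (Γ ⇒ Δ') := by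
  revert Δ' hΔ
  refine induct (motive := fun Γ Δ => ∀ {Δ'}, Δ = none → Derivable L (Γ ⇒ Δ'))
    ?_ ?_ ?_ ?_ ?_ ?_ ?_ ?_ ?_ ?_ ?_ ?_ h
  · intro Γ n Δ' h
    cases h
  · exact fun Γ _ Δ' _ => .botL Γ Δ'
  · exact fun Γ Δ A B h _ _ ih Δ' hΔ => .impL h (ih hΔ)
  · intro Γ A B _ _ Δ' h
    cases h
  · intro Γ A B _ _ _ _ Δ' h
    cases h
  · exact fun Γ Δ A B _ ih Δ' hΔ => .andL (ih hΔ)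
  · intro Γ A B _ _ Δ' h
    cases h
  · intro Γ A B _ _ Δ' h
    cases h
  · exact fun Γ Δ A B _ _ ih₁ ih₂ Δ' hΔ => .orL (ih₁ hΔ) (ih₂ hΔ)
  · rintro Γ Ξ D r k Θ Δ hr hs hk h _ Δ' rfl
    cases hk
    exact .modal hr (.of_shape hs (.none Δ')) h
  · exact fun Γ Δ A hT _ ih Δ' hΔ => .modal hT (.Tbox _ _ _) (ih hΔ)
  · intro Γ A _ _ _ Δ' h
    cases h


theorem weakenLeft {Γ : Multiset Formula} {Δ : Option Formula} (h : Derivable L (Γ ⇒ Δ))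
    (X : Multiset Formula) : Derivable L (Γ + X ⇒ Δ) := by
  revert X
  refine induct (motive := fun Γ Δ => ∀ X, Derivable L (Γ + X ⇒ Δ))
    ?_ ?_ ?_ ?_ ?_ ?_ ?_ ?_ ?_ ?_ ?_ ?_ h <;> try simp only [Multiset.cons_add]
  · exact fun Γ n X => .init _ n
  · exact fun Γ Δ X => .botL _ Δ
  · exact fun Γ Δ A B _ _ ih₁ ih₂ X => .impL (ih₁ X) (ih₂ X)
  · exact fun Γ A B _ ih X => .impR (ih X)
  · exact fun Γ A B _ _ ih₁ ih₂ X => .andR (ih₁ X) (ih₂ X)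
  · exact fun Γ Δ A B _ ih X => .andL (ih X)
  · exact fun Γ A B _ ih X => .orR₁ (ih X)
  · exact fun Γ A B _ ih X => .orR₂ (ih X)
  · exact fun Γ Δ A B _ _ ih₁ ih₂ X => .orL (ih₁ X) (ih₂ X)
  · intro Γ Ξ D r k Θ Δ hr hs hk h _ X
    rw [show Γ + Ξ.map box + D.map dia + X = (Γ + X) + Ξ.map box + D.map dia by abel]
    exact .modal hr (.of_shape hs hk) h
  · exact fun Γ Δ A hT _ ih X => .modal hT (.Tbox _ _ _) (ih X)
  · exact fun Γ A hT _ ih X => .modal hT (.Tdia _ _) (ih X)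

/-- The rules of the shapes in `L.Jump` are admissible. -/
theorem jump {Γ Ξ D : Multiset Formula} {k : Target} {Θ Δ : Option Formula}
    (hJ : L.Jump Ξ.card D.card k) (hk : k.Rel Θ Δ) (h : Derivable L (Ξ + D ⇒ Θ)) :
    Derivable L (Γ + Ξ.map box + D.map dia ⇒ Δ) := by
  rcases hJ with ⟨hn, hd, rfl⟩ | ⟨r, hr, hs⟩
  · rw [Multiset.card_eq_zero] at hn hd
    subst hn hd
    cases hk
    simpa using (h.weakenRight rfl).weakenLeft Γ
  · exact .modal hr (.of_shape hs hk) h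

/-- `Invertible F X`: a left rule of `G3i` replaces the principal formula `F` by `X` in one of its
premisses, and this premiss is derivable whenever the conclusion is. -/
inductive Invertible : Formula → Multiset Formula → Prop
  | and (A B : Formula) : Invertible (and A B) {A, B}
  | orLeft (A B : Formula) : Invertible (or A B) {A}
  | orRight (A B : Formula) : Invertible (or A B) {B}
  | imp (A B : Formula) : Invertible (imp A B) {B}

theorem invert {F : Formula} {X Γ : Multiset Formula} {Δ : Option Formula}
    (hF : Invertible F X) (h : Derivable L (F ::ₘ Γ ⇒ Δ)) : Derivable L (X + Γ ⇒ Δ) := by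
  -- The principal formula of a left rule is either `F` or a member of the remaining context.
  have split : ∀ {P : Formula} {Γ Γ₀ : Multiset Formula}, P ::ₘ Γ = F ::ₘ Γ₀ →
      (P = F ∧ Γ = Γ₀) ∨ ∃ Γ₁, Γ = F ::ₘ Γ₁ ∧ Γ₀ = P ::ₘ Γ₁ := by
    intro P Γ Γ₀ h
    rcases Multiset.cons_eq_cons.1 h with h | ⟨-, h⟩
    exacts [.inl h, .inr h]
  suffices ∀ Γ₀, F ::ₘ Γ = F ::ₘ Γ₀ → Derivable L (X + Γ₀ ⇒ Δ) from this Γ rfl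
  refine induct (motive := fun Γ Δ => ∀ Γ₀, Γ = F ::ₘ Γ₀ → Derivable L (X + Γ₀ ⇒ Δ))
    ?_ ?_ ?_ ?_ ?_ ?_ ?_ ?_ ?_ ?_ ?_ ?_ h
  · intro Γ n Γ₀ h
    rcases split h with ⟨rfl, rfl⟩ | ⟨Γ₁, rfl, rfl⟩
    · cases hF
    · rw [Multiset.add_cons]
      exact .init _ n
  · intro Γ Δ Γ₀ h
    rcases split h with ⟨rfl, rfl⟩ | ⟨Γ₁, rfl, rfl⟩
    · cases hF
    · rw [Multiset.add_cons]
      exact .botL _ Δ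
  · intro Γ Δ A B _ h₂ ih₁ ih₂ Γ₀ h
    rcases split h with ⟨rfl, rfl⟩ | ⟨Γ₁, rfl, rfl⟩
    · cases hF
      simpa using h₂
    · have h₁ := ih₁ (imp A B ::ₘ Γ₁) (Multiset.cons_swap _ _ _)
      have h₂ := ih₂ (B ::ₘ Γ₁) (Multiset.cons_swap _ _ _)
      rw [Multiset.add_cons] at h₁ h₂ ⊢
      exact .impL h₁ h₂
  · rintro Γ A B _ ih Γ₀ rfl
    have h := ih (A ::ₘ Γ₀) (Multiset.cons_swap _ _ _)
    rw [Multiset.add_cons] at h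
    exact .impR h
  · exact fun Γ A B _ _ ih₁ ih₂ Γ₀ h => .andR (ih₁ _ h) (ih₂ _ h)
  · intro Γ Δ A B h' ih Γ₀ h
    rcases split h with ⟨rfl, rfl⟩ | ⟨Γ₁, rfl, rfl⟩
    · cases hF
      simpa using h'
    · have h := ih (A ::ₘ B ::ₘ Γ₁) (by rw [Multiset.cons_swap B, Multiset.cons_swap A])
      rw [Multiset.add_cons, Multiset.add_cons] at h
      rw [Multiset.add_cons]
      exact .andL h
  · exact fun Γ A B _ ih Γ₀ h => .orR₁ (ih _ h)
  · exact fun Γ A B _ ih Γ₀ h => .orR₂ (ih _ h)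
  · intro Γ Δ A B h₁ h₂ ih₁ ih₂ Γ₀ h
    rcases split h with ⟨rfl, rfl⟩ | ⟨Γ₁, rfl, rfl⟩
    · cases hF
      · simpa using h₁
      · simpa using h₂
    · have h₁ := ih₁ (A ::ₘ Γ₁) (Multiset.cons_swap _ _ _)
      have h₂ := ih₂ (B ::ₘ Γ₁) (Multiset.cons_swap _ _ _)
      rw [Multiset.add_cons] at h₁ h₂ ⊢
      exact .orL h₁ h₂
  · intro Γ Ξ D r k Θ Δ hr hs hk h _ Γ₀ hΓ
    have hmem : F ∈ Γ := by
      have : F ∈ Γ + Ξ.map box + D.map dia := hΓ ▸ Multiset.mem_cons_self F Γ₀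
      rcases Multiset.mem_add.1 this with this | this
      · rcases Multiset.mem_add.1 this with this | this
        · exact this
        · obtain ⟨A, -, rfl⟩ := Multiset.mem_map.1 this
          cases hF
      · obtain ⟨A, -, rfl⟩ := Multiset.mem_map.1 this
        cases hF
    obtain ⟨Γ₁, rfl⟩ := Multiset.exists_cons_of_mem hmem
    simp only [Multiset.cons_add, Multiset.cons_inj_right] at hΓ
    rw [← hΓ, ← add_assoc, ← add_assoc]
    exact .modal hr (.of_shape hs hk) h
  · intro Γ Δ A hT _ ih Γ₀ h
    rcases split h with ⟨rfl, rfl⟩ | ⟨Γ₁, rfl, rfl⟩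
    · cases hF
    · have h := ih (A ::ₘ box A ::ₘ Γ₁)
        (by rw [Multiset.cons_swap (box A), Multiset.cons_swap A])
      rw [Multiset.add_cons, Multiset.add_cons] at h
      rw [Multiset.add_cons]
      exact .modal hT (.Tbox _ _ _) h
  · exact fun Γ A hT _ ih Γ₀ h => .modal hT (.Tdia _ _) (ih _ h)

theorem contract {A : Formula} {Γ : Multiset Formula} {Δ : Option Formula}
    (h : Derivable L (A ::ₘ A ::ₘ Γ ⇒ Δ)) : Derivable L (A ::ₘ Γ ⇒ Δ) := by
  -- The induction on `A` serves the cases in which both copies of `A` are principal, or in which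
  -- inverting the rule on the second copy leaves copies of its components.
  induction hn : sizeOf A using Nat.strong_induction_on generalizing A Γ Δ with
  | _ n IH =>
  subst hn
  have split : ∀ {P : Formula} {Γ Γ₀ : Multiset Formula}, P ::ₘ Γ = A ::ₘ A ::ₘ Γ₀ →
      (P = A ∧ Γ = A ::ₘ Γ₀) ∨ ∃ Γ₁, Γ = A ::ₘ A ::ₘ Γ₁ ∧ Γ₀ = P ::ₘ Γ₁ := by
    intro P Γ Γ₀ h
    rcases Multiset.cons_eq_cons.1 h with h | ⟨hne, Γ₁, rfl, h'⟩
    · exact .inl h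
    · rcases Multiset.cons_eq_cons.1 h' with ⟨h', -⟩ | ⟨-, Γ₂, rfl, rfl⟩
      exacts [(hne h'.symm).elim, .inr ⟨_, rfl, rfl⟩]
  have swap : ∀ (P : Formula) (Γ : Multiset Formula),
      P ::ₘ A ::ₘ A ::ₘ Γ = A ::ₘ A ::ₘ P ::ₘ Γ := by
    intro P Γ
    rw [Multiset.cons_swap, Multiset.cons_swap P]
  suffices ∀ Γ₀, A ::ₘ A ::ₘ Γ = A ::ₘ A ::ₘ Γ₀ → Derivable L (A ::ₘ Γ₀ ⇒ Δ) from this Γ rfl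
  refine induct (motive := fun Γ Δ => ∀ Γ₀, Γ = A ::ₘ A ::ₘ Γ₀ → Derivable L (A ::ₘ Γ₀ ⇒ Δ))
    ?_ ?_ ?_ ?_ ?_ ?_ ?_ ?_ ?_ ?_ ?_ ?_ h
  · intro Γ n Γ₀ h
    rcases split h with ⟨rfl, rfl⟩ | ⟨Γ₁, rfl, rfl⟩
    · exact .init _ n
    · rw [Multiset.cons_swap]
      exact .init _ n
  · intro Γ Δ Γ₀ h
    rcases split h with ⟨rfl, rfl⟩ | ⟨Γ₁, rfl, rfl⟩
    · exact .botL _ Δ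
    · rw [Multiset.cons_swap]
      exact .botL _ Δ
  · intro Γ Δ B C _ h₂ ih₁ ih₂ Γ₀ h
    rcases split h with ⟨rfl, rfl⟩ | ⟨Γ₁, rfl, rfl⟩
    · rw [Multiset.cons_swap] at h₂
      have h₂ := h₂.invert (.imp B C)
      exact .impL (ih₁ _ rfl) (IH _ (by simp) h₂ rfl)
    · have h₁ := ih₁ (imp B C ::ₘ Γ₁) (swap _ _)
      have h₂ := ih₂ (C ::ₘ Γ₁) (swap _ _)
      rw [Multiset.cons_swap] at h₁ h₂ ⊢
      exact .impL h₁ h₂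
  · rintro Γ B C _ ih Γ₀ rfl
    have h := ih (B ::ₘ Γ₀) (swap _ _)
    rw [Multiset.cons_swap] at h
    exact .impR h
  · exact fun Γ B C _ _ ih₁ ih₂ Γ₀ h => .andR (ih₁ _ h) (ih₂ _ h)
  · intro Γ Δ B C h' ih Γ₀ h
    rcases split h with ⟨rfl, rfl⟩ | ⟨Γ₁, rfl, rfl⟩
    · rw [show B ::ₘ C ::ₘ and B C ::ₘ Γ₀ = and B C ::ₘ B ::ₘ C ::ₘ Γ₀ by
        rw [Multiset.cons_swap C, Multiset.cons_swap B]] at h'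
      have h' := h'.invert (.and B C)
      have h' : Derivable L (B ::ₘ B ::ₘ C ::ₘ C ::ₘ Γ₀ ⇒ Δ) := by
        simpa [Multiset.cons_swap C B] using h'
      have h' := IH _ (by simp; omega) h' rfl
      rw [Multiset.cons_swap, Multiset.cons_swap B] at h'
      have h' := IH _ (by simp) h' rfl
      rw [Multiset.cons_swap] at h'
      exact .andL h'
    · have h := ih (B ::ₘ C ::ₘ Γ₁) (by
        simp only [← Multiset.singleton_add]
        abel)
      rw [Multiset.cons_swap, Multiset.cons_swap A] at h
      rw [Multiset.cons_swap]
      exact .andL h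
  · exact fun Γ B C _ ih Γ₀ h => .orR₁ (ih _ h)
  · exact fun Γ B C _ ih Γ₀ h => .orR₂ (ih _ h)
  · intro Γ Δ B C h₁ h₂ ih₁ ih₂ Γ₀ h
    rcases split h with ⟨rfl, rfl⟩ | ⟨Γ₁, rfl, rfl⟩
    · rw [Multiset.cons_swap] at h₁ h₂
      exact .orL (IH _ (by simp; omega) (h₁.invert (.orLeft B C)) rfl)
        (IH _ (by simp) (h₂.invert (.orRight B C)) rfl)
    · have h₁ := ih₁ (B ::ₘ Γ₁) (swap _ _)
      have h₂ := ih₂ (C ::ₘ Γ₁) (swap _ _)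
      rw [Multiset.cons_swap] at h₁ h₂ ⊢
      exact .orL h₁ h₂
  · intro Γ Ξ D r k Θ Δ hr hs hk h _ Γ₀ hΓ
    have hJ : L.Jump Ξ.card D.card k := .inr ⟨r, hr, hs⟩
    by_cases hA : A ∈ Γ
    · obtain ⟨Γ₁, rfl⟩ := Multiset.exists_cons_of_mem hA
      simp only [Multiset.cons_add, Multiset.cons_inj_right] at hΓ
      rw [← hΓ]
      exact .jump hJ hk h
    have hmem : ∀ {X Y : Multiset Formula}, A ∈ Γ + X + Y → A ∈ X ∨ A ∈ Y := by
      intro X Y h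
      simp only [Multiset.mem_add] at h
      tauto
    have hA₁ : A ∈ Γ + Ξ.map box + D.map dia := hΓ ▸ Multiset.mem_cons_self _ _
    rcases hmem hA₁ with hA₁ | hA₁
    · obtain ⟨B, hB, rfl⟩ := Multiset.mem_map.1 hA₁
      obtain ⟨Ξ, rfl⟩ := Multiset.exists_cons_of_mem hB
      simp only [Multiset.map_cons, Multiset.add_cons, Multiset.cons_add,
        Multiset.cons_inj_right] at hΓ
      have hA₂ : box B ∈ Γ + Ξ.map box + D.map dia := hΓ ▸ Multiset.mem_cons_self _ _
      have hB : B ∈ Ξ := by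
        rcases hmem hA₂ with h | h
        · simpa using h
        · simp at h
      obtain ⟨Ξ, rfl⟩ := Multiset.exists_cons_of_mem hB
      rw [← hΓ]
      rw [Multiset.cons_add, Multiset.cons_add] at h
      rw [Multiset.card_cons, Multiset.card_cons] at hJ
      refine .jump (Ξ := B ::ₘ Ξ) (by simpa using hJ.contract) hk ?_
      rw [Multiset.cons_add]
      exact IH _ (by simp) h rfl
    · -- At most one formula `◇B` is principal, so `A` cannot occur twice.
      obtain ⟨B, hB, rfl⟩ := Multiset.mem_map.1 hA₁
      obtain ⟨D, rfl⟩ := Multiset.exists_cons_of_mem hB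
      have hD : D = 0 := by
        have := hJ.dia_le_one
        rw [Multiset.card_cons] at this
        exact Multiset.card_eq_zero.1 (by omega)
      subst hD
      simp only [Multiset.map_cons, Multiset.add_cons, Multiset.cons_inj_right] at hΓ
      have hA₂ : dia B ∈ Γ + Ξ.map box + Multiset.map dia 0 := hΓ ▸ Multiset.mem_cons_self _ _
      rcases hmem hA₂ with h | h <;> simp at h
  · intro Γ Δ B hT _ ih Γ₀ h
    rcases split h with ⟨rfl, rfl⟩ | ⟨Γ₁, rfl, rfl⟩
    · have h := ih (B ::ₘ Γ₀) (swap _ _)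
      rw [Multiset.cons_swap] at h
      exact .modal hT (.Tbox _ _ _) h
    · have h := ih (B ::ₘ box B ::ₘ Γ₁) (by
        simp only [← Multiset.singleton_add]
        abel)
      rw [Multiset.cons_swap, Multiset.cons_swap A] at h
      rw [Multiset.cons_swap]
      exact .modal hT (.Tbox _ _ _) h
  · exact fun Γ B hT _ ih Γ₀ h => .modal hT (.Tdia _ _) (ih _ h)

/-- Weakening and contraction together: derivability is monotone in the set of formulas that occur
in the antecedent. -/
theorem mono {Γ Γ' : Multiset Formula} {Δ : Option Formula} (h : Derivable L (Γ ⇒ Δ))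
    (hΓ : Γ ⊆ Γ') : Derivable L (Γ' ⇒ Δ) := by
  have h := h.weakenLeft Γ'
  clear * - h hΓ
  induction Γ using Multiset.induction_on with
  | empty => simpa using h
  | cons A Γ ih =>
    rw [Multiset.cons_subset] at hΓ
    obtain ⟨Γ'', hΓ''⟩ := Multiset.exists_cons_of_mem (Multiset.mem_add.2 (.inr hΓ.1) : A ∈ Γ + Γ')
    refine ih hΓ.2 ?_
    rw [Multiset.cons_add, hΓ''] at h
    rw [hΓ'']
    exact h.contract

/-! ### Rules with membership side conditions -/

variable {Γ : Multiset Formula} {Δ : Option Formula} {A B : Formula}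

theorem init' {n : ℕ} (h : var n ∈ Γ) : Derivable L (Γ ⇒ some (var n)) :=
  (Derivable.init 0 n).mono (by simpa using h)

theorem botL' (h : bot ∈ Γ) : Derivable L (Γ ⇒ Δ) :=
  (Derivable.botL 0 Δ).mono (by simpa using h)

theorem impL' (h : imp A B ∈ Γ) (h₁ : Derivable L (Γ ⇒ some A))
    (h₂ : Derivable L (B ::ₘ Γ ⇒ Δ)) : Derivable L (Γ ⇒ Δ) :=
  (Derivable.impL (h₁.mono (Multiset.subset_cons _ _)) h₂).mono (by simp [Multiset.cons_subset, h])

theorem andL' (h : and A B ∈ Γ) (h₁ : Derivable L (A ::ₘ B ::ₘ Γ ⇒ Δ)) : Derivable L (Γ ⇒ Δ) :=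
  (Derivable.andL h₁).mono (by simp [Multiset.cons_subset, h])

theorem orL' (h : or A B ∈ Γ) (h₁ : Derivable L (A ::ₘ Γ ⇒ Δ)) (h₂ : Derivable L (B ::ₘ Γ ⇒ Δ)) :
    Derivable L (Γ ⇒ Δ) :=
  (Derivable.orL h₁ h₂).mono (by simp [Multiset.cons_subset, h])

theorem jump' {Ξ D : Multiset Formula} {k : Target} {Θ : Option Formula}
    (hJ : L.Jump Ξ.card D.card k) (hk : k.Rel Θ Δ) (hΞ : Ξ.map box ⊆ Γ) (hD : D.map dia ⊆ Γ)
    (h : Derivable L (Ξ + D ⇒ Θ)) : Derivable L (Γ ⇒ Δ) :=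
  (jump (Γ := 0) hJ hk h).mono (by
    intro C hC
    simp only [zero_add, Multiset.mem_add] at hC
    exact hC.elim (@hΞ C) (@hD C))

theorem Tbox' (hT : .Tbox ∈ L.rules) (h : box A ∈ Γ) (h₁ : Derivable L (A ::ₘ Γ ⇒ Δ)) :
    Derivable L (Γ ⇒ Δ) :=
  (Derivable.modal hT (.Tbox Γ Δ A)
    (h₁.mono (Multiset.cons_subset_cons (Multiset.subset_cons _ _)))).mono
    (by simp [Multiset.cons_subset, h])

/-- Several applications of `T_□`. -/
theorem Tbox_add (hT : .Tbox ∈ L.rules) {Ξ : Multiset Formula} (hΞ : Ξ.map box ⊆ Γ)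
    (h : Derivable L (Ξ + Γ ⇒ Δ)) : Derivable L (Γ ⇒ Δ) := by
  induction Ξ using Multiset.induction_on with
  | empty => simpa using h
  | cons A Ξ ih =>
    rw [Multiset.map_cons, Multiset.cons_subset] at hΞ
    rw [Multiset.cons_add] at h
    exact ih hΞ.2 (h.Tbox' hT (Multiset.mem_add.2 (.inr hΞ.1)))

theorem Tdia' (hT : .Tdia ∈ L.rules) (h : Derivable L (Γ ⇒ some A)) :
    Derivable L (Γ ⇒ some (dia A)) :=
  .modal hT (.Tdia Γ A) h

theorem refl (h : A ∈ Γ) : Derivable L (Γ ⇒ some A) := by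
  induction A generalizing Γ with
  | var n => exact init' h
  | bot => exact botL' h
  | and A B ihA ihB => exact .andR (andL' h (ihA (by simp))) (andL' h (ihB (by simp)))
  | or A B ihA ihB => exact orL' h (.orR₁ (ihA (by simp))) (.orR₂ (ihB (by simp)))
  | imp A B ihA ihB =>
    exact .impR (impL' (Multiset.mem_cons_of_mem h) (ihA (by simp)) (ihB (by simp)))
  | box A ih =>
    exact jump' (Ξ := {A}) (D := 0) (.box_self L) (.box A) (by simpa using h) (by simp)
      (ih (by simp))
  | dia A ih =>
    exact jump' (Ξ := 0) (D := {A}) (.dia_self L) (.dia A) (by simp) (by simpa using h)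
      (ih (by simp))

end Derivable

/-! ### Admissibility of cut -/

/-- Cut on `A` is admissible. The second premiss may have any antecedent with members among
those of `A, Γ`. -/
def CutAdmissible (L : WLogic) (A : Formula) : Prop :=
  ∀ (Γ Γ' : Multiset Formula) (Δ : Option Formula), Derivable L (Γ ⇒ some A) →
    Derivable L (Γ' ⇒ Δ) → Γ' ⊆ A ::ₘ Γ → Derivable L (Γ ⇒ Δ)

/-- `RightForm L Γ A`: the sequent `Γ ⇒ A` follows by an initial sequent for `A`, or by a rule
that introduces `A` on the right, from derivable premisses. -/
def RightForm (L : WLogic) (Γ : Multiset Formula) : Formula → Prop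
  | var n => var n ∈ Γ
  | bot => False
  | Formula.and A B => Derivable L (Γ ⇒ some A) ∧ Derivable L (Γ ⇒ some B)
  | Formula.or A B => Derivable L (Γ ⇒ some A) ∨ Derivable L (Γ ⇒ some B)
  | imp A B => Derivable L (A ::ₘ Γ ⇒ some B)
  | box A => ∃ Ξ D : Multiset Formula, L.Jump Ξ.card D.card .box ∧ Ξ.map box ⊆ Γ ∧
      D.map dia ⊆ Γ ∧ Derivable L (Ξ + D ⇒ some A)
  | dia A => (∃ Ξ D : Multiset Formula, L.Jump Ξ.card D.card .dia ∧ Ξ.map box ⊆ Γ ∧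
      D.map dia ⊆ Γ ∧ Derivable L (Ξ + D ⇒ some A)) ∨
      (.Tdia ∈ L.rules ∧ Derivable L (Γ ⇒ some A))

variable {L : WLogic}

theorem RightForm.mono {Γ Γ' : Multiset Formula} {A : Formula} (h : RightForm L Γ A)
    (hΓ : Γ ⊆ Γ') : RightForm L Γ' A := by
  cases A with
  | var n => exact hΓ h
  | bot => exact h
  | and A B => exact ⟨h.1.mono hΓ, h.2.mono hΓ⟩
  | or A B => exact h.imp (·.mono hΓ) (·.mono hΓ)
  | imp A B => exact Derivable.mono h (Multiset.cons_subset_cons hΓ)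
  | box A =>
    obtain ⟨Ξ, D, hJ, hΞ, hD, h⟩ := h
    exact ⟨Ξ, D, hJ, Multiset.Subset.trans hΞ hΓ, Multiset.Subset.trans hD hΓ, h⟩
  | dia A =>
    rcases h with ⟨Ξ, D, hJ, hΞ, hD, h⟩ | ⟨hT, h⟩
    · exact .inl ⟨Ξ, D, hJ, Multiset.Subset.trans hΞ hΓ, Multiset.Subset.trans hD hΓ, h⟩
    · exact .inr ⟨hT, h.mono hΓ⟩

/-- The modal rule with premiss `Ξ, D ⇒ Θ`, when a formula `□A` introduced on the right is cut
against all its occurrences among `□Ξ`: cut `A` out of the premiss. -/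
theorem RightForm.cut_box_jump {Γ Ξ D : Multiset Formula} {k : Target} {Θ Δ : Option Formula}
    {A : Formula} (hcut : CutAdmissible L A) (hR : RightForm L Γ (box A))
    (hJ : L.Jump Ξ.card D.card k) (hk : k.Rel Θ Δ) (h : Derivable L (Ξ + D ⇒ Θ))
    (hΞ : Ξ.map box ⊆ box A ::ₘ Γ) (hD : D.map dia ⊆ box A ::ₘ Γ) : Derivable L (Γ ⇒ Δ) := by
  classical
  have hD : D.map dia ⊆ Γ := by
    intro C hC
    obtain ⟨B, -, rfl⟩ := Multiset.mem_map.1 hC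
    simpa using hD hC
  have hΞ : (Ξ.filter (· ≠ A)).map box ⊆ Γ := by
    intro C hC
    obtain ⟨B, hB, rfl⟩ := Multiset.mem_map.1 hC
    obtain ⟨hB, hne⟩ := Multiset.mem_filter.1 hB
    simpa [hne] using hΞ (Multiset.mem_map_of_mem box hB)
  by_cases hA : A ∈ Ξ
  · obtain ⟨Ξ₁, D₁, hJ₁, hΞ₁, hD₁, h₁⟩ := hR
    obtain ⟨m, hm⟩ : ∃ m, Ξ.card = m + 1 :=
      Nat.exists_eq_succ_of_ne_zero (Multiset.card_pos_iff_exists_mem.2 ⟨A, hA⟩).ne'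
    have hlt : (Ξ.filter (· ≠ A)).card < Ξ.card :=
      Multiset.card_lt_card (lt_of_le_of_ne (Multiset.filter_le _ _) fun he => by
        rw [← he] at hA
        exact (Multiset.mem_filter.1 hA).2 rfl)
    have hJ' : L.Jump (Ξ₁ + Ξ.filter (· ≠ A)).card (D₁ + D).card k := by
      rw [Multiset.card_add, Multiset.card_add]
      exact hJ₁.cut_box (hJ.of_le (by omega) hlt)
    refine Derivable.jump' hJ' hk ?_ ?_ (hcut _ (Ξ + D) _ (h₁.mono ?_) h ?_)
    · intro C hC
      rw [Multiset.map_add, Multiset.mem_add] at hC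
      exact hC.elim (@hΞ₁ C) (@hΞ C)
    · intro C hC
      rw [Multiset.map_add, Multiset.mem_add] at hC
      exact hC.elim (@hD₁ C) (@hD C)
    · intro C hC
      simp only [Multiset.mem_add] at hC ⊢
      tauto
    · intro C hC
      simp only [Multiset.mem_add, Multiset.mem_cons, Multiset.mem_filter] at hC ⊢
      tauto
  · have hself : Ξ.filter (· ≠ A) = Ξ := Multiset.filter_eq_self.2 fun B hB hBA => hA (hBA ▸ hB)
    rw [hself] at hΞ
    exact Derivable.jump' hJ hk hΞ hD h

/-- The modal rule with premiss `Ξ, D ⇒ Θ`, when a formula `◇A` introduced on the right is cut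
against the principal formula `◇A`. -/
theorem RightForm.cut_dia_jump {Γ Ξ D : Multiset Formula} {k : Target} {Θ Δ : Option Formula}
    {A : Formula} (hcut : CutAdmissible L A) (hR : RightForm L Γ (dia A))
    (hJ : L.Jump Ξ.card D.card k) (hk : k.Rel Θ Δ) (h : Derivable L (Ξ + D ⇒ Θ))
    (hΞ : Ξ.map box ⊆ dia A ::ₘ Γ) (hD : D.map dia ⊆ dia A ::ₘ Γ) : Derivable L (Γ ⇒ Δ) := by
  have hΞ : Ξ.map box ⊆ Γ := by
    intro C hC
    obtain ⟨B, -, rfl⟩ := Multiset.mem_map.1 hC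
    simpa using hΞ hC
  by_cases hA : A ∈ D
  · obtain ⟨D, rfl⟩ := Multiset.exists_cons_of_mem hA
    have hD0 : D = 0 := by
      have := hJ.dia_le_one
      rw [Multiset.card_cons] at this
      exact Multiset.card_eq_zero.1 (by omega)
    subst hD0
    rcases hR with ⟨Ξ₁, D₁, hJ₁, hΞ₁, hD₁, h₁⟩ | ⟨hT, h₁⟩
    · have hJ' : L.Jump (Ξ₁ + Ξ).card D₁.card k := by
        rw [Multiset.card_add]
        exact hJ₁.cut_dia hJ
      refine Derivable.jump' hJ' hk ?_ hD₁ (hcut _ (Ξ + {A}) _ (h₁.mono ?_) h ?_)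
      · intro C hC
        rw [Multiset.map_add, Multiset.mem_add] at hC
        exact hC.elim (@hΞ₁ C) (@hΞ C)
      · intro C hC
        simp only [Multiset.mem_add] at hC ⊢
        tauto
      · intro C hC
        simp only [Multiset.mem_add, Multiset.mem_cons, Multiset.mem_singleton] at hC ⊢
        tauto
    · have h₂ : Derivable L (Γ ⇒ Θ) := by
        refine Derivable.Tbox_add (L.Tbox_mem_iff_Tdia_mem.2 hT) hΞ
          (hcut _ (Ξ + {A}) _ (h₁.mono (Multiset.subset_of_le le_add_self)) h ?_)
        intro C hC
        simp only [Multiset.mem_add, Multiset.mem_cons, Multiset.mem_singleton] at hC ⊢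
        tauto
      cases hk with
      | none => exact h₂.weakenRight rfl
      | box B => exact absurd hJ.not_dia_of_box (by simp)
      | dia B => exact h₂.Tdia' hT
  · refine Derivable.jump' hJ hk hΞ ?_ h
    intro C hC
    obtain ⟨B, hB, rfl⟩ := Multiset.mem_map.1 hC
    have hne : B ≠ A := fun h => hA (h ▸ hB)
    simpa [hne] using hD hC

/-- Cut when the last rule of the left derivation introduces the cut formula `A`. The cut is moved
up the right derivation; where `A` is principal there, it is replaced by cuts on the components
of `A`. -/
theorem RightForm.cut {A : Formula}
    (hcut : ∀ B : Formula, sizeOf B < sizeOf A → CutAdmissible L B) {Γ Γ' : Multiset Formula}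
    {Δ : Option Formula} (hR : RightForm L Γ A) (h : Derivable L (Γ' ⇒ Δ))
    (hΓ : Γ' ⊆ A ::ₘ Γ) : Derivable L (Γ ⇒ Δ) := by
  revert Γ
  -- The context of a premiss of the right derivation has one or two more formulas.
  have step : ∀ {B : Formula} {Γ₀ Γ : Multiset Formula}, Γ₀ ⊆ A ::ₘ Γ →
      B ::ₘ Γ₀ ⊆ A ::ₘ B ::ₘ Γ := by
    intro B Γ₀ Γ h
    rw [Multiset.cons_swap]
    exact Multiset.cons_subset_cons h
  refine fun {Γ} => Derivable.induct
    (motive := fun Γ' Δ => ∀ {Γ}, RightForm L Γ A → Γ' ⊆ A ::ₘ Γ → Derivable L (Γ ⇒ Δ))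
    ?_ ?_ ?_ ?_ ?_ ?_ ?_ ?_ ?_ ?_ ?_ ?_ h
  · intro Γ₀ n Γ hR hΓ
    rcases Multiset.mem_cons.1 (hΓ (Multiset.mem_cons_self _ _)) with rfl | h
    exacts [.init' hR, .init' h]
  · intro Γ₀ Δ Γ hR hΓ
    rcases Multiset.mem_cons.1 (hΓ (Multiset.mem_cons_self _ _)) with rfl | h
    exacts [hR.elim, .botL' h]
  · intro Γ₀ Δ B C _ _ ih₁ ih₂ Γ hR hΓ
    have hB := ih₁ hR hΓ
    obtain ⟨hmem, hΓ⟩ := Multiset.cons_subset.1 hΓ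
    have hC := ih₂ (hR.mono (Multiset.subset_cons _ _)) (step hΓ)
    rcases Multiset.mem_cons.1 hmem with rfl | h
    · exact hcut C (by simp) _ _ _ (hcut B (by simp; omega) _ _ _ hB hR (fun _ h => h)) hC
        (fun _ h => h)
    · exact .impL' h hB hC
  · exact fun Γ₀ B C _ ih Γ hR hΓ => .impR (ih (hR.mono (Multiset.subset_cons _ _)) (step hΓ))
  · exact fun Γ₀ B C _ _ ih₁ ih₂ Γ hR hΓ => .andR (ih₁ hR hΓ) (ih₂ hR hΓ)
  · intro Γ₀ Δ B C _ ih Γ hR hΓ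
    obtain ⟨hmem, hΓ⟩ := Multiset.cons_subset.1 hΓ
    have h' := ih ((hR.mono (Multiset.subset_cons Γ C)).mono (Multiset.subset_cons _ B))
      (step (step hΓ))
    rcases Multiset.mem_cons.1 hmem with rfl | h
    · exact hcut C (by simp) _ _ _ hR.2 (hcut B (by simp; omega) _ _ _
        (hR.1.mono (Multiset.subset_cons _ _)) h' (fun _ h => h)) (fun _ h => h)
    · exact .andL' h h'
  · exact fun Γ₀ B C _ ih Γ hR hΓ => .orR₁ (ih hR hΓ)
  · exact fun Γ₀ B C _ ih Γ hR hΓ => .orR₂ (ih hR hΓ)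
  · intro Γ₀ Δ B C _ _ ih₁ ih₂ Γ hR hΓ
    obtain ⟨hmem, hΓ⟩ := Multiset.cons_subset.1 hΓ
    have hB := ih₁ (hR.mono (Multiset.subset_cons _ _)) (step hΓ)
    have hC := ih₂ (hR.mono (Multiset.subset_cons _ _)) (step hΓ)
    rcases Multiset.mem_cons.1 hmem with rfl | h
    · rcases hR with hR | hR
      · exact hcut B (by simp; omega) _ _ _ hR hB (fun _ h => h)
      · exact hcut C (by simp) _ _ _ hR hC (fun _ h => h)
    · exact .orL' h hB hC
  · intro Γ₀ Ξ D r k Θ Δ hr hs hk h _ Γ hR hΓ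
    have hJ : L.Jump Ξ.card D.card k := .inr ⟨r, hr, hs⟩
    have hΞ : Ξ.map box ⊆ A ::ₘ Γ := fun C hC => hΓ (by simp [hC])
    have hD : D.map dia ⊆ A ::ₘ Γ := fun C hC => hΓ (by simp [hC])
    have of_ne : (∀ B, A ≠ box B) → (∀ B, A ≠ dia B) → Derivable L (Γ ⇒ Δ) := by
      intro hbox hdia
      refine .jump' hJ hk ?_ ?_ h <;> intro C hC
      · obtain ⟨B, -, rfl⟩ := Multiset.mem_map.1 hC
        simpa [(hbox B).symm] using hΞ hC
      · obtain ⟨B, -, rfl⟩ := Multiset.mem_map.1 hC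
        simpa [(hdia B).symm] using hD hC
    cases A with
    | box A => exact hR.cut_box_jump (hcut A (by simp)) hJ hk h hΞ hD
    | dia A => exact hR.cut_dia_jump (hcut A (by simp)) hJ hk h hΞ hD
    | _ => exact of_ne (by simp) (by simp)
  · intro Γ₀ Δ B hT _ ih Γ hR hΓ
    have h' := ih (hR.mono (Multiset.subset_cons Γ B)) (step hΓ)
    rcases Multiset.mem_cons.1 (Multiset.cons_subset.1 hΓ).1 with rfl | h
    · -- The rule that introduced `□B` on the right has premiss `Ξ ⇒ B` with `□Ξ` in the context;
      -- after a cut on `B`, the formulas `Ξ` are absorbed by `T_□`.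
      obtain ⟨Ξ, D, hJ, hΞ, hD, h⟩ := hR
      obtain rfl : D = 0 := Multiset.card_eq_zero.1 hJ.not_dia_of_box
      refine .Tbox_add hT hΞ (hcut B (by simp) _ (B ::ₘ Γ) _ (h.mono ?_) h' ?_)
      · intro C hC
        simpa using Or.inl (by simpa using hC)
      · exact Multiset.cons_subset_cons (Multiset.subset_of_le le_add_self)
    · exact .Tbox' hT h h'
  · exact fun Γ₀ B hT _ ih Γ hR hΓ => .Tdia' hT (ih hR hΓ)

/-- Admissibility of cut. The cut is moved up the left derivation until its last rule introduces
the cut formula. -/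
theorem cutAdmissible (L : WLogic) (A : Formula) : CutAdmissible L A := by
  induction hn : sizeOf A using Nat.strong_induction_on generalizing A with
  | _ n IH =>
  subst hn
  have hR : ∀ {Γ Γ' : Multiset Formula} {Δ : Option Formula}, RightForm L Γ A →
      Derivable L (Γ' ⇒ Δ) → Γ' ⊆ A ::ₘ Γ → Derivable L (Γ ⇒ Δ) :=
    fun hR => hR.cut fun B hB => IH _ hB B rfl
  intro Γ Γ' Δ h h' hΓ'
  have step : ∀ {B : Formula} {Γ : Multiset Formula}, Γ' ⊆ A ::ₘ Γ → Γ' ⊆ A ::ₘ B ::ₘ Γ :=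
    fun h => Multiset.Subset.trans h (Multiset.cons_subset_cons (Multiset.subset_cons _ _))
  suffices ∀ Γ₁, Γ ⊆ Γ₁ → Γ' ⊆ A ::ₘ Γ₁ → Derivable L (Γ₁ ⇒ Δ) from this Γ (fun _ h => h) hΓ'
  refine Derivable.induct (motive := fun Γ Θ => Θ = some A → ∀ Γ₁, Γ ⊆ Γ₁ → Γ' ⊆ A ::ₘ Γ₁ →
    Derivable L (Γ₁ ⇒ Δ)) ?_ ?_ ?_ ?_ ?_ ?_ ?_ ?_ ?_ ?_ ?_ ?_ h rfl
  · rintro Γ n ⟨⟩ Γ₁ hΓ hΓ'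
    exact hR (hΓ (Multiset.mem_cons_self _ _)) h' hΓ'
  · exact fun Γ _ _ Γ₁ hΓ _ => .botL' (hΓ (Multiset.mem_cons_self _ _))
  · intro Γ Θ B C h₁ _ _ ih hΘ Γ₁ hΓ hΓ'
    obtain ⟨hmem, hΓ₁⟩ := Multiset.cons_subset.1 hΓ
    exact .impL' hmem (h₁.mono hΓ) (ih hΘ _ (Multiset.cons_subset_cons hΓ₁) (step hΓ'))
  · rintro Γ B C h₁ _ ⟨⟩ Γ₁ hΓ hΓ'
    exact hR (h₁.mono (Multiset.cons_subset_cons hΓ)) h' hΓ'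
  · rintro Γ B C h₁ h₂ _ _ ⟨⟩ Γ₁ hΓ hΓ'
    exact hR ⟨h₁.mono hΓ, h₂.mono hΓ⟩ h' hΓ'
  · intro Γ Θ B C _ ih hΘ Γ₁ hΓ hΓ'
    obtain ⟨hmem, hΓ₁⟩ := Multiset.cons_subset.1 hΓ
    exact .andL' hmem (ih hΘ _ (Multiset.cons_subset_cons (Multiset.cons_subset_cons hΓ₁))
      (step (step hΓ')))
  · rintro Γ B C h₁ _ ⟨⟩ Γ₁ hΓ hΓ'
    exact hR (.inl (h₁.mono hΓ)) h' hΓ'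
  · rintro Γ B C h₁ _ ⟨⟩ Γ₁ hΓ hΓ'
    exact hR (.inr (h₁.mono hΓ)) h' hΓ'
  · intro Γ Θ B C _ _ ih₁ ih₂ hΘ Γ₁ hΓ hΓ'
    obtain ⟨hmem, hΓ₁⟩ := Multiset.cons_subset.1 hΓ
    exact .orL' hmem (ih₁ hΘ _ (Multiset.cons_subset_cons hΓ₁) (step hΓ'))
      (ih₂ hΘ _ (Multiset.cons_subset_cons hΓ₁) (step hΓ'))
  · rintro Γ Ξ D r k Θ₀ Θ hr hs hk h₁ _ rfl Γ₁ hΓ hΓ'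
    have hJ : L.Jump Ξ.card D.card k := .inr ⟨r, hr, hs⟩
    have hΞ : Ξ.map box ⊆ Γ₁ := fun C hC => hΓ (by simp [hC])
    have hD : D.map dia ⊆ Γ₁ := fun C hC => hΓ (by simp [hC])
    cases hk with
    | none => exact .jump' hJ (.none Δ) hΞ hD h₁
    | box B => exact hR ⟨Ξ, D, hJ, hΞ, hD, h₁⟩ h' hΓ'
    | dia B => exact hR (.inl ⟨Ξ, D, hJ, hΞ, hD, h₁⟩) h' hΓ'
  · intro Γ Θ B hT _ ih hΘ Γ₁ hΓ hΓ'
    exact .Tbox' hT (Multiset.cons_subset.1 hΓ).1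
      (ih hΘ _ (Multiset.cons_subset_cons hΓ) (step hΓ'))
  · rintro Γ B hT h₁ _ ⟨⟩ Γ₁ hΓ hΓ'
    exact hR (.inr ⟨hT, h₁.mono hΓ⟩) h' hΓ'

theorem Derivable.cut {Γ : Multiset Formula} {Δ : Option Formula} {A : Formula}
    (h : Derivable L (Γ ⇒ some A)) (h' : Derivable L (A ::ₘ Γ ⇒ Δ)) : Derivable L (Γ ⇒ Δ) :=
  cutAdmissible L A _ _ _ h h' (fun _ h => h)

/-! ### From Hilbert proofs to sequent derivations -/

theorem IPLAxiom.derivable {A : Formula} (h : IPLAxiom A) : Derivable L (0 ⇒ some A) := by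
  cases h with
  | k A B => exact .impR (.impR (.refl (by simp)))
  | s A B C =>
    refine .impR (.impR (.impR ?_))
    refine .impL' (A := A) (B := imp B C) (by simp) (.refl (by simp)) ?_
    refine .impL' (A := A) (B := B) (by simp) (.refl (by simp)) ?_
    exact .impL' (A := B) (B := C) (by simp) (.refl (by simp)) (.refl (by simp))
  | andLeft A B => exact .impR (.andL (.refl (by simp)))
  | andRight A B => exact .impR (.andL (.refl (by simp)))
  | andIntro A B => exact .impR (.impR (.andR (.refl (by simp)) (.refl (by simp))))
  | orLeft A B => exact .impR (.orR₁ (.refl (by simp)))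
  | orRight A B => exact .impR (.orR₂ (.refl (by simp)))
  | orElim A B C =>
    refine .impR (.impR (.impR (.orL ?_ ?_)))
    · exact .impL' (A := A) (B := C) (by simp) (.refl (by simp)) (.refl (by simp))
    · exact .impL' (A := B) (B := C) (by simp) (.refl (by simp)) (.refl (by simp))
  | exFalso A => exact .impR (.botL _ _)

theorem WLogic.jump_of_Nbox (h : .Nbox ∈ L.axioms) : L.Jump 0 0 .box := by
  cases L <;> simp [WLogic.axioms, WLogic.Jump, WLogic.rules, RuleName.Shape] at h ⊢

theorem WLogic.jump_of_Cbox (h : .Cbox ∈ L.axioms) : L.Jump 2 0 .box := by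
  cases L <;> simp [WLogic.axioms, WLogic.Jump, WLogic.rules, RuleName.Shape] at h ⊢

theorem WLogic.jump_of_Kdia (h : .Kdia ∈ L.axioms) : L.Jump 1 1 .dia := by
  cases L <;> simp [WLogic.axioms, WLogic.Jump, WLogic.rules, RuleName.Shape] at h ⊢

theorem WLogic.jump_of_Pdia (h : .Pdia ∈ L.axioms) : L.Jump 0 0 .dia := by
  cases L <;> simp [WLogic.axioms, WLogic.Jump, WLogic.rules, RuleName.Shape] at h ⊢

theorem WLogic.jump_of_D (h : .D ∈ L.axioms) : L.Jump 1 0 .dia := by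
  cases L <;> simp [WLogic.axioms, WLogic.Jump, WLogic.rules, RuleName.Shape] at h ⊢

theorem WLogic.Tbox_mem_rules (h : .Tbox ∈ L.axioms) : .Tbox ∈ L.rules := by
  cases L <;> simp [WLogic.axioms, WLogic.rules] at h ⊢

theorem WLogic.Tdia_mem_rules (h : .Tdia ∈ L.axioms) : .Tdia ∈ L.rules := by
  cases L <;> simp [WLogic.axioms, WLogic.rules] at h ⊢

theorem ModalAxiom.derivable {a : AxiomName} {A : Formula} (ha : a ∈ L.axioms)
    (h : ModalAxiom a A) : Derivable L (0 ⇒ some A) := by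
  cases h with
  | dualAnd A =>
    refine .impR (.andL (.jump' (Ξ := {A}) (D := {neg A}) (WLogic.Jump.box_dia_none L) (.none _)
      (by simp) (by simp) ?_))
    exact .impL' (A := A) (B := bot) (by simp [neg]) (.refl (by simp)) (.botL _ _)
  | Nbox =>
    exact .jump' (Ξ := 0) (D := 0) (WLogic.jump_of_Nbox ha) (.box _) (by simp) (by simp)
      (.impR (.refl (by simp)))
  | Cbox A B =>
    exact .impR (.andL (.jump' (Ξ := {A, B}) (D := 0) (WLogic.jump_of_Cbox ha) (.box _)
      (by simp) (by simp) (.andR (.refl (by simp)) (.refl (by simp)))))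
  | Kdia A B =>
    refine .impR (.impR (.jump' (Ξ := {imp A B}) (D := {A}) (WLogic.jump_of_Kdia ha) (.dia _)
      (by simp) (by simp) ?_))
    exact .impL' (A := A) (B := B) (by simp) (.refl (by simp)) (.refl (by simp))
  | Pdia =>
    exact .jump' (Ξ := 0) (D := 0) (WLogic.jump_of_Pdia ha) (.dia _) (by simp) (by simp)
      (.impR (.refl (by simp)))
  | D A =>
    exact .impR (.jump' (Ξ := {A}) (D := 0) (WLogic.jump_of_D ha) (.dia _) (by simp) (by simp)
      (.refl (by simp)))
  | Tbox A =>
    exact .impR (.Tbox' (WLogic.Tbox_mem_rules ha) (A := A) (by simp) (.refl (by simp)))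
  | Tdia A =>
    exact .impR (.Tdia' (WLogic.Tdia_mem_rules ha) (.refl (by simp)))

theorem Derivable.of_imp {Γ : Multiset Formula} {A B : Formula}
    (h : Derivable L (Γ ⇒ some (imp A B))) : Derivable L (A ::ₘ Γ ⇒ some B) :=
  (h.mono (Multiset.subset_cons _ _)).cut
    (.impL' (A := A) (B := B) (by simp) (.refl (by simp)) (.refl (by simp)))

theorem Theorem.derivable {A : Formula} (h : Theorem L A) : Derivable L (0 ⇒ some A) := by
  induction h with
  | ipl h => exact h.derivable
  | modal ha h => exact h.derivable ha
  | mp _ _ ih₁ ih₂ => exact ih₂.cut ih₁.of_imp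
  | @monBox A B _ ih =>
    exact .impR (.jump' (Ξ := {A}) (D := 0) (WLogic.Jump.box_self L) (.box B) (by simp) (by simp)
      ih.of_imp)
  | @monDia A B _ ih =>
    exact .impR (.jump' (Ξ := 0) (D := {A}) (WLogic.Jump.dia_self L) (.dia B) (by simp) (by simp)
      ih.of_imp)

theorem Derivable.conj {Γ : Multiset Formula} (A : Formula) (l : List Formula)
    (h : ∀ B ∈ A :: l, B ∈ Γ) : Derivable L (Γ ⇒ some (conj A l)) := by
  induction l generalizing A with
  | nil => exact .refl (h A (by simp))
  | cons B l ih => exact .andR (.refl (h A (by simp))) (ih B fun C hC => h C (by simp [hC]))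

theorem Derivable.of_disj {Γ : Multiset Formula} {Δ : Option Formula}
    (h : Derivable L (Γ ⇒ some (disj Δ))) : Derivable L (Γ ⇒ Δ) := by
  cases Δ with
  | none => exact h.cut (.botL _ _)
  | some A => exact h

theorem Derivable.of_interp {l : List Formula} {Δ : Option Formula}
    (h : Derivable L (0 ⇒ some (interp l Δ))) : Derivable L (l ⇒ Δ) := by
  cases l with
  | nil => exact h.of_disj
  | cons A l =>
    exact of_disj ((Derivable.conj A l (by simp)).cut
      (h.of_imp.mono (by simp)))

/-! ### From sequent derivations to Hilbert proofs -/

/-- `Entails L S A`: the formula `A` follows from the hypotheses `S` and theorems of `L` by modus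
ponens. The monotonicity rules are available for theorems only. -/
inductive Entails (L : WLogic) (S : Set Formula) : Formula → Prop
  | hyp {A : Formula} : A ∈ S → Entails L S A
  | thm {A : Formula} : Theorem L A → Entails L S A
  | mp {A B : Formula} : Entails L S (imp A B) → Entails L S A → Entails L S B

namespace Entails

variable {S T : Set Formula} {A B C : Formula}

theorem ax (h : IPLAxiom A) : Entails L S A := .thm (.ipl h)

theorem trans (h : Entails L S A) (hST : ∀ B ∈ S, Entails L T B) : Entails L T A := by
  induction h with
  | hyp h => exact hST _ h
  | thm h => exact .thm h
  | mp _ _ ih₁ ih₂ => exact .mp ih₁ ih₂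

theorem mono (h : Entails L S A) (hST : S ⊆ T) : Entails L T A :=
  h.trans fun _ hB => .hyp (hST hB)

theorem cut (h : Entails L S A) (h' : Entails L (insert A S) B) : Entails L S B :=
  h'.trans fun C hC => by
    rcases hC with rfl | hC
    exacts [h, .hyp hC]

theorem theorem_of_empty (h : Entails L ∅ A) : Theorem L A := by
  induction h with
  | hyp h => exact h.elim
  | thm h => exact h
  | mp _ _ ih₁ ih₂ => exact .mp ih₁ ih₂

theorem imp_self (A : Formula) : Entails L S (imp A A) :=
  .mp (.mp (.ax (.s A (imp A A) A)) (.ax (.k _ _))) (.ax (.k _ _))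

theorem deduction (h : Entails L (insert A S) B) : Entails L S (imp A B) := by
  induction h with
  | hyp h =>
    rcases h with rfl | h
    exacts [imp_self _, .mp (.ax (.k _ _)) (.hyp h)]
  | thm h => exact .mp (.ax (.k _ _)) (.thm h)
  | mp _ _ ih₁ ih₂ => exact .mp (.mp (.ax (.s _ _ _)) ih₁) ih₂

theorem theorem_imp (h : Entails L {A} B) : Theorem L (imp A B) :=
  theorem_of_empty (deduction (h.mono (by simp)))

theorem exFalso (h : Entails L S bot) : Entails L S A := .mp (.ax (.exFalso A)) h

theorem andIntro (hA : Entails L S A) (hB : Entails L S B) : Entails L S (and A B) :=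
  .mp (.mp (.ax (.andIntro A B)) hA) hB

theorem box (h : Entails L {A} B) (hA : Entails L S (box A)) : Entails L S (box B) :=
  .mp (.thm (.monBox h.theorem_imp)) hA

theorem dia (h : Entails L {A} B) (hA : Entails L S (dia A)) : Entails L S (dia B) :=
  .mp (.thm (.monDia h.theorem_imp)) hA

theorem modal {a : AxiomName} (ha : a ∈ L.axioms) (h : ModalAxiom a A) : Entails L S A :=
  .thm (.modal ha h)

/-- `□A` and `◇B` are contradictory when `A` and `B` are. -/
theorem dual (h : Entails L {A, B} bot) (hA : Entails L S (Formula.box A))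
    (hB : Entails L S (Formula.dia B)) : Entails L S bot := by
  have hdual : AxiomName.dualAnd ∈ L.axioms := by cases L <;> simp [WLogic.axioms]
  exact .mp (.modal hdual (.dualAnd A)) (hA.andIntro (.dia h.deduction hB))

/-- The boxes of finitely many formulas entail the box of their conjunction. -/
theorem exists_box {Ξ : Multiset Formula} (hΞ : Ξ.card = 1 ∨ (1 ≤ Ξ.card ∧ .Cbox ∈ L.axioms))
    (hS : ∀ A ∈ Ξ, Formula.box A ∈ S) :
    ∃ C, Entails L S (Formula.box C) ∧ ∀ A ∈ Ξ, Entails L {C} A := by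
  rcases hΞ with h | ⟨h, hC⟩
  · obtain ⟨A, rfl⟩ := Multiset.card_eq_one.1 h
    exact ⟨A, .hyp (hS A (by simp)), fun B hB => .hyp (by simpa using hB)⟩
  · induction Ξ using Multiset.induction_on with
    | empty => simp at h
    | cons A Ξ ih =>
      by_cases h0 : Ξ = 0
      · subst h0
        exact ⟨A, .hyp (hS A (by simp)), fun B hB => .hyp (by simpa using hB)⟩
      · obtain ⟨C, hC', hΞ⟩ := ih (fun B hB => hS B (by simp [hB])) (Multiset.card_pos.2 h0)
        refine ⟨.and A C, .mp (.modal hC (.Cbox A C)) (.andIntro (.hyp (hS A (by simp))) hC'), ?_⟩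
        intro B hB
        rcases Multiset.mem_cons.1 hB with rfl | hB
        · exact .mp (.ax (.andLeft _ C)) (.hyp rfl)
        · refine (hΞ B hB).trans ?_
          rintro _ rfl
          exact .mp (.ax (.andRight A _)) (.hyp rfl)

end Entails

namespace WLogic.Jump

variable {n d : ℕ} {k : Target}

/-- A rule other than the one with two formulas `□A`, `□B` and arbitrary succedent unboxes more
than one formula only in the presence of `C_□`. -/
theorem Cbox_or (h : L.Jump n d k) (hn : 1 ≤ n) : n = 1 ∨ (1 ≤ n ∧ AxiomName.Cbox ∈ L.axioms) ∨
    (n = 2 ∧ d = 0 ∧ k = .none ∧ .D ∈ L.axioms) := by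
  cases L <;> cases k <;>
    simp [WLogic.axioms, WLogic.Jump, WLogic.rules, RuleName.Shape] at h ⊢ <;> omega

theorem Nbox_of_box (h : L.Jump 0 d .box) : AxiomName.Nbox ∈ L.axioms := by
  cases L <;> simp [WLogic.axioms, WLogic.Jump, WLogic.rules, RuleName.Shape] at h ⊢

theorem Nbox_of_none (h : L.Jump 0 1 .none) : AxiomName.Nbox ∈ L.axioms := by
  cases L <;> simp [WLogic.axioms, WLogic.Jump, WLogic.rules, RuleName.Shape] at h ⊢

theorem Kdia_of_dia (h : L.Jump n 1 .dia) (hn : 1 ≤ n) : AxiomName.Kdia ∈ L.axioms := by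
  cases L <;> simp [WLogic.axioms, WLogic.Jump, WLogic.rules, RuleName.Shape] at h ⊢ <;> omega

theorem D_of_dia (h : L.Jump n 0 .dia) (hn : 1 ≤ n) : AxiomName.D ∈ L.axioms := by
  cases L <;> simp [WLogic.axioms, WLogic.Jump, WLogic.rules, RuleName.Shape] at h ⊢ <;> omega

theorem P_of_dia (h : L.Jump 0 0 .dia) :
    AxiomName.Pdia ∈ L.axioms ∨ (AxiomName.Nbox ∈ L.axioms ∧ AxiomName.D ∈ L.axioms) := by
  cases L <;> simp [WLogic.axioms, WLogic.Jump, WLogic.rules, RuleName.Shape] at h ⊢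

theorem P_of_none (h : L.Jump n 0 .none) (hn : 1 ≤ n) :
    AxiomName.Pdia ∈ L.axioms ∨ (AxiomName.Nbox ∈ L.axioms ∧ AxiomName.D ∈ L.axioms) := by
  cases L <;> simp [WLogic.axioms, WLogic.Jump, WLogic.rules, RuleName.Shape] at h ⊢ <;> omega

end WLogic.Jump

namespace Entails

variable {S : Set Formula} {A B : Formula}

theorem box_top (hN : .Nbox ∈ L.axioms) : Entails L S (Formula.box top) := .modal hN .Nbox

theorem dia_top
    (h : AxiomName.Pdia ∈ L.axioms ∨ (AxiomName.Nbox ∈ L.axioms ∧ AxiomName.D ∈ L.axioms)) :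
    Entails L S (Formula.dia top) := by
  rcases h with h | ⟨hN, hD⟩
  · exact .modal h .Pdia
  · exact .mp (.modal hD (.D top)) (.box_top hN)

/-- The modal rules other than `T_□` and `T_◇` are sound. -/
theorem jump {Ξ D : Multiset Formula} {k : Target} {Θ Δ : Option Formula}
    (hJ : L.Jump Ξ.card D.card k) (hk : k.Rel Θ Δ) (h : Entails L {A | A ∈ Ξ + D} (disj Θ))
    (hΞ : ∀ A ∈ Ξ, Formula.box A ∈ S) (hD : ∀ A ∈ D, Formula.dia A ∈ S) :
    Entails L S (disj Δ) := by
  rcases Nat.eq_zero_or_pos Ξ.card with hn | hn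
  · obtain rfl := Multiset.card_eq_zero.1 hn
    rw [zero_add] at h
    rcases Nat.le_one_iff_eq_zero_or_eq_one.1 hJ.dia_le_one with hd | hd
    · obtain rfl := Multiset.card_eq_zero.1 hd
      have h {T : Set Formula} : Entails L T (disj Θ) := h.mono (by simp)
      cases hk with
      | none => exact h.exFalso
      | box B => exact .box h (.box_top hJ.Nbox_of_box)
      | dia B => exact .dia h (.dia_top hJ.P_of_dia)
    · obtain ⟨A, rfl⟩ := Multiset.card_eq_one.1 hd
      have hA : Entails L S (Formula.dia A) := .hyp (hD A (by simp))
      have h : Entails L {A} (disj Θ) := h.mono (by simp)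
      cases hk with
      | none => exact (dual (h.mono (by simp)) (.box_top hJ.Nbox_of_none) hA).exFalso
      | box B => exact absurd hJ.not_dia_of_box (by simp)
      | dia B => exact .dia h hA
  · have hC := hJ.Cbox_or hn
    rw [← or_assoc] at hC
    rcases hC with hC | ⟨hn2, hd, rfl, hax⟩
    · obtain ⟨C, hC, hCΞ⟩ := exists_box hC hΞ
      rcases Nat.le_one_iff_eq_zero_or_eq_one.1 hJ.dia_le_one with hd | hd
      · obtain rfl := Multiset.card_eq_zero.1 hd
        have h : Entails L {C} (disj Θ) := h.trans fun A hA => hCΞ A (by simpa using hA)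
        cases hk with
        | none =>
          exact (dual (B := top) (h.mono (by simp)) hC (.dia_top (hJ.P_of_none hn))).exFalso
        | box B => exact .box h hC
        | dia B => exact .mp (.modal (hJ.D_of_dia hn) (.D B)) (.box h hC)
      · obtain ⟨A, rfl⟩ := Multiset.card_eq_one.1 hd
        have hA : Entails L S (Formula.dia A) := .hyp (hD A (by simp))
        have h : Entails L {A, C} (disj Θ) := h.trans fun B hB => by
          rcases Multiset.mem_add.1 hB with hB | hB
          · exact (hCΞ B hB).mono (by simp)
          · exact .hyp (by simpa using .inl (by simpa using hB))
        cases hk with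
        | none => exact (dual (h.mono (by simp [Set.pair_comm])) hC hA).exFalso
        | box B => exact absurd hJ.not_dia_of_box (by simp)
        | dia B =>
          exact .mp (.mp (.modal (hJ.Kdia_of_dia hn) (.Kdia A B)) (.box h.deduction hC)) hA
    · obtain ⟨A, B, rfl⟩ := Multiset.card_eq_two.1 hn2
      obtain rfl := Multiset.card_eq_zero.1 hd
      cases hk
      refine exFalso (dual (A := A) (B := B) (h.mono ?_) (.hyp (hΞ A (by simp)))
        (.mp (.modal hax (.D B)) (.hyp (hΞ B (by simp)))))
      intro C hC
      simpa using hC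

theorem conj (A : Formula) (l : List Formula) :
    ∀ B ∈ A :: l, Entails L {conj A l} B := by
  induction l generalizing A with
  | nil => exact fun B hB => .hyp (by simpa [Formula.conj] using hB)
  | cons A' l ih =>
    intro B hB
    rcases List.mem_cons.1 hB with rfl | hB
    · exact .mp (.ax (.andLeft _ _)) (.hyp rfl)
    · refine (ih A' B hB).trans ?_
      rintro _ rfl
      exact .mp (.ax (.andRight A _)) (.hyp rfl)

theorem theorem_interp {l : List Formula} {Δ : Option Formula}
    (h : Entails L {A | A ∈ l} (disj Δ)) : Theorem L (interp l Δ) := by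
  cases l with
  | nil => exact theorem_of_empty (h.mono (by simp))
  | cons A l => exact theorem_imp (h.trans (Entails.conj A l))

end Entails

theorem Derivable.entails {Γ : Multiset Formula} {Δ : Option Formula}
    (h : Derivable L (Γ ⇒ Δ)) : Entails L {A | A ∈ Γ} (disj Δ) := by
  have cons : ∀ (A : Formula) (Γ : Multiset Formula),
      {B | B ∈ A ::ₘ Γ} = insert A {B | B ∈ Γ} := by
    intro A Γ
    ext B
    simp
  refine induct (motive := fun Γ Δ => Entails L {A | A ∈ Γ} (disj Δ))
    ?_ ?_ ?_ ?_ ?_ ?_ ?_ ?_ ?_ ?_ ?_ ?_ h <;> try simp only [cons]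
  · exact fun Γ n => .hyp (by simp [disj])
  · exact fun Γ Δ => .exFalso (.hyp (by simp))
  · intro Γ Δ A B _ _ h₁ h₂
    exact (Entails.mp (A := A) (B := B) (.hyp (by simp)) h₁).cut (h₂.mono (by
      rw [Set.insert_comm]
      exact Set.subset_insert _ _))
  · exact fun Γ A B _ h => h.deduction
  · exact fun Γ A B _ _ h₁ h₂ => h₁.andIntro h₂
  · intro Γ Δ A B _ h
    refine h.trans fun C hC => ?_
    rcases hC with rfl | rfl | hC
    · exact .mp (.ax (.andLeft _ B)) (.hyp (by simp))
    · exact .mp (.ax (.andRight A _)) (.hyp (by simp))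
    · exact .hyp (.inr hC)
  · exact fun Γ A B _ h => .mp (.ax (.orLeft A B)) h
  · exact fun Γ A B _ h => .mp (.ax (.orRight A B)) h
  · intro Γ Δ A B _ _ h₁ h₂
    exact .mp (.mp (.mp (.ax (.orElim A B _)) (h₁.deduction.mono (Set.subset_insert _ _)))
      (h₂.deduction.mono (Set.subset_insert _ _))) (.hyp (by simp))
  · intro Γ Ξ D r k Θ Δ hr hs hk _ h
    exact .jump (.inr ⟨r, hr, hs⟩) hk h (fun A hA => by simp [hA]) (fun A hA => by simp [hA])
  · intro Γ Δ A hT _ h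
    have hT : AxiomName.Tbox ∈ L.axioms := by
      cases L <;> simp [WLogic.axioms, WLogic.rules] at hT ⊢
    exact (Entails.mp (.modal hT (.Tbox A)) (.hyp (by simp))).cut h
  · intro Γ A hT _ h
    have hT : AxiomName.Tdia ∈ L.axioms := by
      cases L <;> simp [WLogic.axioms, WLogic.rules] at hT ⊢
    exact .mp (.modal hT (.Tdia A)) h

end WLogics

theorem mainTheorem4 (L : WLogics.WLogic) (Γ : Multiset WLogics.Formula)
    (Δ : Option WLogics.Formula) (l : List WLogics.Formula)
    (hl : (l : Multiset WLogics.Formula) = Γ) :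
    WLogics.Derivable L (WLogics.Sequent.mk Γ Δ) ↔
      WLogics.Theorem L (WLogics.Formula.interp l Δ) := by
  subst hl
  exact ⟨fun h => h.entails.theorem_interp, fun h => h.derivable.of_interp⟩
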